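/- Conventions. A category is quasi-pointed if it has an initial object $0$ and a terminal object $1$ and $0\to 1$ is a monomorphism. A morphism is zero if it factors over $0$; the kernel $\ker f\colon K[f]\to A$ of $f\colon A\to B$ is the pullback of $0\to B$ along $f$, and a cokernel of $f$ is a pushout of $A\to 0$ along $f$. A category is sequentiable if it is quasi-pointed, regular and (Bourn) protomodular; it is (Barr) exact if it is regular and every internal equivalence relation is a kernel pair. A morphism is proper if its image (the monic part of its factorization as a regular epimorphism followed by a monomorphism) is a kernel. A sequence $X\xrightarrow{f}Y\xrightarrow{g}Z$ is exact at $Y$ if the image of $f$ is the kernel of $g$; $K\xrightarrow{k}A\xrightarrow{f}B$ is short exact, written $0\to K\to A\to B\to 1$, if $k=\ker f$ and $f$ is a cokernel of $k$. A sequence ending in $X\xrightarrow{f} Y\to 1$ is called exact if it is exact at all objects before $Y$ and $f$ is a regular epimorphism. A positively graded chain complex $K$ consists of morphisms $d_n\colon K_n\to K_{n-1}$ ($n\ge 1$) with $d_n\circ d_{n+1}$ zero; it is proper if every $d_n$ is proper. $\mathsf{Ch}^+\mathcal A$ is the category of these complexes and $\mathsf{PCh}^+\mathcal A$ its full subcategory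 of proper ones; a sequence in $\mathsf{PCh}^+\mathcal A$ is called exact if it is so in $\mathsf{Ch}^+\mathcal A$. For proper $K$ in a sequentiable category, $H_nK$ is the cokernel of $K_{n+1}\to K[d_n]$ for $n\ge 1$, and $H_0K$ is the cokernel of $d_1$. For a simplicial object $A$ with faces $\partial_i$, the Moore complex $N(A)$ has $N_0A=A_0$, $N_nA=\bigcap_{i=0}^{n-1}K[\partial_i\colon A_n\to A_{n-1}]$, and boundary operators $d_n\colon N_nA\to N_{n-1}A$ induced by $\partial_n$. A morphism $f\colon A\to B$ of simplicial objects is a Kan fibration if, for all $n\ge 1$ and $0\le k\le n$, every family $(x_i\colon X\to A_{n-1})_{0\le i\le n,\, i\ne k}$ with $\partial_i x_j=\partial_{j-1}x_i$ for $i<j$, $i,j\neq k$, and every $b\colon X\to B_n$ with $\partial_i b=f_{n-1}x_i$ for $i\ne k$, there are a regular epimorphism $p\colon Y\to X$ and a morphism $a\colon Y\to A_n$ with $f_n a=bp$ and $\partial_i a=x_ip$ for all $i\ne k$. Theorem. Let $\mathcal A$ be an exact and sequentiable category, and let $\mathcal{SA}$ be its category of simplicial objects. (1) Every regular epimorphism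 in $\mathcal{SA}$ is a Kan fibration. (2) The Moore complex $N(A)$ of every simplicial object $A$ of $\mathcal A$ is proper, so that $N$ is a functor $\mathcal{SA}\to\mathsf{PCh}^+\mathcal A$ and $H_nA=H_nN(A)$ is defined for $n\ge 0$. (3) The functor $N\colon\mathcal{SA}\to\mathsf{PCh}^+\mathcal A$ is exact: it preserves sequences exact at a given object, short exact sequences, and regular epimorphisms (i.e. exact sequences $X\to Y\to 1$; a morphism of $\mathsf{PCh}^+\mathcal A$ counts as a regular epimorphism here if it is one in $\mathsf{Ch}^+\mathcal A$). (4) Every short exact sequence $0\to A''\to A'\to A\to 1$ in $\mathcal{SA}$ gives rise to a long exact sequence $$\cdots\to H_{n+1}A\xrightarrow{\delta_{n+1}}H_nA''\to H_nA'\to H_nA\xrightarrow{\delta_n}H_{n-1}A''\to\cdots\to H_1A\xrightarrow{\delta_1}H_0A''\to H_0A'\to H_0A\to 1,$$ which depends naturally on the given short exact sequence of simplicial objects. -/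

import Mathlib

open CategoryTheory CategoryTheory.Limits

universe v u

namespace SemiAbelian

/-! ### Zero morphisms, kernels, cokernels and exact sequences

All these notions are formulated in an arbitrary category by means of its initial objects
(which are unique up to unique isomorphism); they are used in quasi-pointed categories. -/

section Basic

variable {C : Type u} [Category.{v} C]

/-- A zero morphism is a morphism that factors through an initial object. -/
def IsZeroHom {X Y : C} (f : X ⟶ Y) : Prop :=
  ∃ (Z : C) (hZ : IsInitial Z) (h : X ⟶ Z), h ≫ hZ.to Y = f

/-- `k` is a kernel of `f`: the pullback of `0 ⟶ B` along `f : A ⟶ B`. -/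
def IsKer {K A B : C} (k : K ⟶ A) (f : A ⟶ B) : Prop :=
  ∃ (Z : C) (hZ : IsInitial Z) (h : K ⟶ Z), IsPullback k h f (hZ.to B)

/-- `q` is a cokernel of `f`: the pushout of `A ⟶ 0` along `f : A ⟶ B`
(in particular, a morphism `A ⟶ 0` has to exist). -/
def IsCoker {A B Q : C} (f : A ⟶ B) (q : B ⟶ Q) : Prop :=
  ∃ (Z : C) (hZ : IsInitial Z) (h : A ⟶ Z), IsPushout f h q (hZ.to Q)

/-- A morphism is proper when its image is a kernel. The image of `f` is the monomorphism `m` in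
its factorization `f = e ≫ m` as a regular epimorphism followed by a monomorphism
(a kernel is always a monomorphism). -/
def IsProper {A B : C} (f : A ⟶ B) : Prop :=
  ∃ (I : C) (e : A ⟶ I) (m : I ⟶ B), IsRegularEpi e ∧ e ≫ m = f ∧
    ∃ (D : C) (g : B ⟶ D), IsKer m g

/-- The sequence `A ⟶ B ⟶ D` is exact at `B`: the image of `f` is a kernel of `g`. -/
def IsExactAt {A B D : C} (f : A ⟶ B) (g : B ⟶ D) : Prop :=
  ∃ (I : C) (e : A ⟶ I) (m : I ⟶ B), IsRegularEpi e ∧ e ≫ m = f ∧ IsKer m g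

/-- `K ⟶ A ⟶ B` is a short exact sequence: `k` is a kernel of `f` and `f` a cokernel of `k`. -/
def IsShortExact {K A B : C} (k : K ⟶ A) (f : A ⟶ B) : Prop :=
  IsKer k f ∧ IsCoker k f

/-- A functor is exact if it preserves exact sequences: sequences exact at a given object,
short exact sequences `0 ⟶ K ⟶ A ⟶ B ⟶ 1`, and exact sequences `A ⟶ B ⟶ 1`
(the latter meaning that `A ⟶ B` is a regular epimorphism). -/
structure IsExactFunctor {D : Type*} [Category* D] (F : C ⥤ D) : Prop where
  isExactAt : ∀ {X Y Z : C} (f : X ⟶ Y) (g : Y ⟶ Z), IsExactAt f g →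
    IsExactAt (F.map f) (F.map g)
  isShortExact : ∀ {X Y Z : C} (k : X ⟶ Y) (f : Y ⟶ Z), IsShortExact k f →
    IsShortExact (F.map k) (F.map f)
  isRegularEpi : ∀ {X Y : C} (f : X ⟶ Y), IsRegularEpi f → IsRegularEpi (F.map f)

end Basic

/-! ### Exact and sequentiable categories -/

section Classes

variable (C : Type u) [Category.{v} C]

/-- A category with an initial object `0` and a terminal object `1` such that `0 ⟶ 1` is a
monomorphism. -/
class QuasiPointed : Prop where
  hasInitial : HasInitial C
  hasTerminal : HasTerminal C
  mono : Mono (initial.to (⊤_ C))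

/-- Bourn protomodularity. In a commutative diagram
```
  X --f--> Y --g--> Z
  |a       |b       |c
  X' -f'-> Y' -g'-> Z'
```
with `b` a split epimorphism, if the outer rectangle and the left hand square are pullbacks,
then so is the right hand square. -/
class Protomodular : Prop where
  isPullback_right : ∀ {X Y Z X' Y' Z' : C} (f : X ⟶ Y) (g : Y ⟶ Z) (f' : X' ⟶ Y') (g' : Y' ⟶ Z')
    (a : X ⟶ X') (b : Y ⟶ Y') (c : Z ⟶ Z'), IsSplitEpi b → CommSq g b c g' →
    IsPullback (f ≫ g) a c (f' ≫ g') → IsPullback f a b f' → IsPullback g b c g'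

/-- A sequentiable category: quasi-pointed, regular and protomodular. -/
class Sequentiable : Prop extends Regular C, QuasiPointed C, Protomodular C

/-- A (Barr) exact category: a regular category in which every internal equivalence relation is
a kernel pair. -/
class BarrExact : Prop extends Regular C where
  exists_isKernelPair : ∀ {R X : C} (p₁ p₂ : R ⟶ X), IsEquivalenceRelation p₁ p₂ →
    ∃ (Y : C) (f : X ⟶ Y), IsKernelPair f p₁ p₂

attribute [instance] QuasiPointed.hasInitial QuasiPointed.hasTerminal

end Classes

/-! ### Facts on zero morphisms, kernels and cokernels -/

section Facts

variable {C : Type u} [Category.{v} C]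

section QP

variable [QuasiPointed C]

theorem hom_ext_of_isInitial {X Z : C} (hZ : IsInitial Z) (a b : X ⟶ Z) : a = b := by
  have : Mono (initial.to (⊤_ C)) := QuasiPointed.mono
  have e : a ≫ hZ.to (⊥_ C) = b ≫ hZ.to (⊥_ C) := by
    rw [← cancel_mono (initial.to (⊤_ C))]
    exact Subsingleton.elim _ _
  have i : hZ.to (⊥_ C) ≫ initial.to Z = 𝟙 Z := hZ.hom_ext _ _
  simpa [i] using congrArg (fun t => t ≫ initial.to Z) e

theorem IsZeroHom.eq {X Y : C} {f g : X ⟶ Y} (hf : IsZeroHom f) (hg : IsZeroHom g) : f = g := by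
  obtain ⟨Z, hZ, h, rfl⟩ := hf
  obtain ⟨Z', hZ', h', rfl⟩ := hg
  have i : hZ.to Y = hZ.to Z' ≫ hZ'.to Y := hZ.hom_ext _ _
  rw [i, ← Category.assoc, hom_ext_of_isInitial hZ' (h ≫ hZ.to Z') h']

end QP

theorem IsZeroHom.lift {X Y Z : C} {f : X ⟶ Y} (hf : IsZeroHom f) (hZ : IsInitial Z) :
    ∃ h : X ⟶ Z, h ≫ hZ.to Y = f := by
  obtain ⟨Z', hZ', h, rfl⟩ := hf
  refine ⟨h ≫ hZ'.to Z, ?_⟩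
  rw [Category.assoc, hZ'.hom_ext (hZ'.to Z ≫ hZ.to Y) (hZ'.to Y)]

theorem IsZeroHom.comp {X Y Y' : C} {f : X ⟶ Y} (hf : IsZeroHom f) (g : Y ⟶ Y') :
    IsZeroHom (f ≫ g) := by
  obtain ⟨Z, hZ, h, rfl⟩ := hf
  refine ⟨Z, hZ, h, ?_⟩
  rw [Category.assoc, hZ.hom_ext (hZ.to Y ≫ g) (hZ.to Y')]

theorem IsZeroHom.precomp {X X' Y : C} {f : X ⟶ Y} (hf : IsZeroHom f) (g : X' ⟶ X) :
    IsZeroHom (g ≫ f) := by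
  obtain ⟨Z, hZ, h, rfl⟩ := hf
  exact ⟨Z, hZ, g ≫ h, by simp⟩

theorem IsZeroHom.of_comp_mono {X Y Y' : C} {f : X ⟶ Y} {m : Y ⟶ Y'} [Mono m]
    (h : IsZeroHom (f ≫ m)) : IsZeroHom f := by
  obtain ⟨Z, hZ, t, e⟩ := h
  refine ⟨Z, hZ, t, ?_⟩
  rw [← cancel_mono m, ← e, Category.assoc, hZ.hom_ext (hZ.to Y ≫ m) (hZ.to Y')]

theorem isZeroHom_of_isInitial {X Y Z : C} (hZ : IsInitial Z) (h : X ⟶ Z) (g : Z ⟶ Y) :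
    IsZeroHom (h ≫ g) := ⟨Z, hZ, h, by rw [hZ.hom_ext (hZ.to Y) g]⟩

theorem IsKer.isZeroHom {K A B : C} {k : K ⟶ A} {f : A ⟶ B} (hk : IsKer k f) :
    IsZeroHom (k ≫ f) := by
  obtain ⟨Z, hZ, h, p⟩ := hk
  exact ⟨Z, hZ, h, p.w.symm⟩

theorem IsKer.lift [QuasiPointed C] {K A B X : C} {k : K ⟶ A} {f : A ⟶ B} (hk : IsKer k f)
    (g : X ⟶ A) (hg : IsZeroHom (g ≫ f)) : ∃ t : X ⟶ K, t ≫ k = g := by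
  obtain ⟨Z, hZ, h, p⟩ := hk
  obtain ⟨t, ht⟩ := hg.lift hZ
  exact ⟨p.lift g t ht.symm, p.lift_fst _ _ _⟩

theorem IsKer.mono [QuasiPointed C] {K A B : C} {k : K ⟶ A} {f : A ⟶ B} (hk : IsKer k f) :
    Mono k := by
  obtain ⟨Z, hZ, h, p⟩ := hk
  exact ⟨fun a b e => p.hom_ext e (hom_ext_of_isInitial hZ _ _)⟩

theorem isPullback_of_lift [QuasiPointed C] {K A B Z : C} {k : K ⟶ A} {f : A ⟶ B} [Mono k]
    (hl : ∀ {X : C} (g : X ⟶ A), IsZeroHom (g ≫ f) → ∃ t : X ⟶ K, t ≫ k = g)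
    (hZ : IsInitial Z) (h : K ⟶ Z) (hz : IsZeroHom (k ≫ f)) : IsPullback k h f (hZ.to B) := by
  refine ⟨⟨hz.eq ⟨Z, hZ, h, rfl⟩⟩, ⟨PullbackCone.IsLimit.mk _
    (fun s => (hl s.fst ⟨Z, hZ, s.snd, s.condition.symm⟩).choose)
    (fun s => (hl s.fst ⟨Z, hZ, s.snd, s.condition.symm⟩).choose_spec)
    (fun s => hom_ext_of_isInitial hZ _ _) ?_⟩⟩
  intro s m hm _
  rw [← cancel_mono k, hm]
  exact (hl s.fst ⟨Z, hZ, s.snd, s.condition.symm⟩).choose_spec.symm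

theorem IsKer.of_lift [QuasiPointed C] {K A B : C} {k : K ⟶ A} {f : A ⟶ B} [Mono k]
    (hz : IsZeroHom (k ≫ f))
    (hl : ∀ {X : C} (g : X ⟶ A), IsZeroHom (g ≫ f) → ∃ t : X ⟶ K, t ≫ k = g) : IsKer k f := by
  obtain ⟨Z, hZ, h, _⟩ := id hz
  exact ⟨Z, hZ, h, isPullback_of_lift hl hZ h hz⟩

theorem IsCoker.isZeroHom {A B Q : C} {f : A ⟶ B} {q : B ⟶ Q} (hq : IsCoker f q) :
    IsZeroHom (f ≫ q) := by
  obtain ⟨Z, hZ, h, p⟩ := hq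
  exact ⟨Z, hZ, h, p.w.symm⟩

theorem IsCoker.epi {A B Q : C} {f : A ⟶ B} {q : B ⟶ Q} (hq : IsCoker f q) : Epi q := by
  obtain ⟨Z, hZ, h, p⟩ := hq
  exact ⟨fun a b e => p.hom_ext e (hZ.hom_ext _ _)⟩

theorem IsCoker.desc [QuasiPointed C] {A B Q X : C} {f : A ⟶ B} {q : B ⟶ Q} (hq : IsCoker f q)
    (g : B ⟶ X) (hg : IsZeroHom (f ≫ g)) : ∃ t : Q ⟶ X, q ≫ t = g := by
  obtain ⟨Z, hZ, h, p⟩ := hq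
  have w : f ≫ g = h ≫ hZ.to X := hg.eq ⟨Z, hZ, h, rfl⟩
  exact ⟨p.desc g (hZ.to X) w, p.inl_desc _ _ _⟩

theorem IsCoker.of_desc [QuasiPointed C] {A B Q : C} {f : A ⟶ B} {q : B ⟶ Q} [Epi q]
    (hz : IsZeroHom (f ≫ q))
    (hd : ∀ {X : C} (g : B ⟶ X), IsZeroHom (f ≫ g) → ∃ t : Q ⟶ X, q ≫ t = g) : IsCoker f q := by
  obtain ⟨Z, hZ, h, e⟩ := hz
  have hs : ∀ s : PushoutCocone f h, IsZeroHom (f ≫ s.inl) := fun s => by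
    rw [s.condition]; exact isZeroHom_of_isInitial hZ h s.inr
  refine ⟨Z, hZ, h, ⟨⟨e.symm⟩, ⟨PushoutCocone.IsColimit.mk _
    (fun s => (hd s.inl (hs s)).choose) (fun s => (hd s.inl (hs s)).choose_spec)
    (fun s => hZ.hom_ext _ _) ?_⟩⟩⟩
  intro s m hm _
  rw [← cancel_epi q, hm]
  exact (hd s.inl (hs s)).choose_spec.symm

end Facts

/-! ### Chosen kernels -/

section Kernels

variable {C : Type u} [Category.{v} C] [HasPullbacks C] [QuasiPointed C]

/-- The kernel object `K[f]`. -/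
noncomputable def ker {A B : C} (f : A ⟶ B) : C := pullback f (initial.to B)

/-- The kernel morphism `K[f] ⟶ A`. -/
noncomputable def kerι {A B : C} (f : A ⟶ B) : ker f ⟶ A := pullback.fst f (initial.to B)

theorem isKer_kerι {A B : C} (f : A ⟶ B) : IsKer (kerι f) f :=
  ⟨⊥_ C, initialIsInitial, pullback.snd f (initial.to B), by
    rw [initialIsInitial.hom_ext (initialIsInitial.to B) (initial.to B)]
    exact IsPullback.of_hasPullback f (initial.to B)⟩

instance {A B : C} (f : A ⟶ B) : Mono (kerι f) := (isKer_kerι f).mono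

/-- The morphism into the kernel of `f` induced by `g` with `g ≫ f` zero. -/
noncomputable def kerLift {X A B : C} (f : A ⟶ B) (g : X ⟶ A) (h : IsZeroHom (g ≫ f)) :
    X ⟶ ker f := ((isKer_kerι f).lift g h).choose

@[simp]
theorem kerLift_ι {X A B : C} (f : A ⟶ B) (g : X ⟶ A) (h : IsZeroHom (g ≫ f)) :
    kerLift f g h ≫ kerι f = g := ((isKer_kerι f).lift g h).choose_spec

/-- The morphism between kernels induced by a commutative square. -/
noncomputable def kerMap {A B A' B' : C} {f : A ⟶ B} {f' : A' ⟶ B'} {a : A ⟶ A'} {b : B ⟶ B'}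
    (w : a ≫ f' = f ≫ b) : ker f ⟶ ker f' :=
  kerLift f' (kerι f ≫ a) (by
    rw [Category.assoc, w, ← Category.assoc]
    exact (isKer_kerι f).isZeroHom.comp b)

@[simp]
theorem kerMap_ι {A B A' B' : C} {f : A ⟶ B} {f' : A' ⟶ B'} {a : A ⟶ A'} {b : B ⟶ B'}
    (w : a ≫ f' = f ≫ b) : kerMap w ≫ kerι f' = kerι f ≫ a := kerLift_ι _ _ _

end Kernels

/-! ### Cokernels of proper morphisms -/

section Cokernels

variable {C : Type u} [Category.{v} C] [Sequentiable C]

/-- In a sequentiable category a regular epimorphism is a cokernel of its kernel. -/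
theorem isCoker_kerι {A B : C} (e : A ⟶ B) [IsRegularEpi e] : IsCoker (kerι e) e := by
  have key : ∀ {X : C} (g : A ⟶ X), IsZeroHom (kerι e ≫ g) →
      pullback.fst e e ≫ g = pullback.snd e e ≫ g := by
    intro X g hg
    let p₀ := pullback.fst e e
    let p₁ := pullback.snd e e
    let m := equalizer.ι (p₀ ≫ g) (p₁ ≫ g)
    let s : A ⟶ equalizer (p₀ ≫ g) (p₁ ≫ g) :=
      equalizer.lift (pullback.lift (𝟙 A) (𝟙 A) rfl) (by
        rw [← Category.assoc, ← Category.assoc]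
        simp [p₀, p₁, pullback.lift_fst, pullback.lift_snd])
    have hs : s ≫ m = pullback.lift (𝟙 A) (𝟙 A) rfl := equalizer.lift_ι _ _
    have hsplit : IsSplitEpi (m ≫ p₀) := ⟨⟨⟨s, by
      rw [← Category.assoc, hs]; exact pullback.lift_fst _ _ _⟩⟩⟩
    have hz : p₀ ≫ e = p₁ ≫ e := pullback.condition
    have hj₀ : IsZeroHom (kerι p₀ ≫ p₀) := (isKer_kerι p₀).isZeroHom
    have hj₁ : IsZeroHom ((kerι p₀ ≫ p₁) ≫ e) := by
      rw [Category.assoc, ← hz, ← Category.assoc]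
      exact hj₀.comp e
    obtain ⟨t, ht⟩ := (isKer_kerι e).lift _ hj₁
    let j : ker p₀ ⟶ equalizer (p₀ ≫ g) (p₁ ≫ g) := equalizer.lift (kerι p₀) (by
      refine IsZeroHom.eq ?_ ?_
      · rw [← Category.assoc]; exact hj₀.comp g
      · rw [← Category.assoc, ← ht, Category.assoc]; exact hg.precomp t)
    have hj : j ≫ m = kerι p₀ := equalizer.lift_ι _ _
    obtain ⟨Z, hZ, h, p⟩ := isKer_kerι p₀
    have : Mono j := mono_of_mono_fac hj
    have left : IsPullback j h (m ≫ p₀) (hZ.to A) := by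
      refine isPullback_of_lift ?_ hZ h (by rw [← Category.assoc, hj]; exact hj₀)
      intro Y y hy
      obtain ⟨t, ht⟩ := (isKer_kerι p₀).lift (y ≫ m) (by simpa using hy)
      exact ⟨t, by rw [← cancel_mono m, Category.assoc, hj, ht]⟩
    have outer : IsPullback (j ≫ m) h p₀ (hZ.to A ≫ 𝟙 A) := by simpa [hj] using p
    have right := Protomodular.isPullback_right j m (hZ.to A) (𝟙 A) h (m ≫ p₀) p₀ hsplit
      ⟨by simp⟩ outer left
    have : IsIso m := right.isIso_fst_of_isIso
    rw [← cancel_epi m]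
    exact equalizer.condition (p₀ ≫ g) (p₁ ≫ g)
  have fac : ∀ {X : C} (g : A ⟶ X), IsZeroHom (kerι e ≫ g) →
      IsRegularEpi.left e ≫ g = IsRegularEpi.right e ≫ g := by
    intro X g hg
    have w := IsRegularEpi.w e
    have h₀ := pullback.lift_fst (f := e) (g := e) _ _ w
    have h₁ := pullback.lift_snd (f := e) (g := e) _ _ w
    rw [← h₀, Category.assoc, key g hg, ← Category.assoc, h₁]
  have : Epi e := inferInstance
  exact IsCoker.of_desc (isKer_kerι e).isZeroHom
    (fun g hg => ⟨IsRegularEpi.desc e g (fac g hg), IsRegularEpi.fac e _ _⟩)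

/-- Proper morphisms have cokernels. -/
theorem IsProper.exists_isCoker {A B : C} {f : A ⟶ B} (hf : IsProper f) :
    ∃ (Q : C) (q : B ⟶ Q), IsCoker f q := by
  obtain ⟨I, e, m, he, rfl, D, g, hm⟩ := hf
  let F := Regular.strongEpiMonoFactorisation g
  have hF : F.e ≫ F.m = g := F.fac
  have : IsRegularEpi F.e := inferInstanceAs
    (IsRegularEpi (Regular.strongEpiMonoFactorisation g).e)
  have : Epi e := inferInstance
  have : Epi F.e := inferInstance
  have hq := isCoker_kerι F.e
  obtain ⟨Z, hZ, h, p⟩ := id hm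
  have hz : IsZeroHom (m ≫ F.e) := by
    refine ⟨Z, hZ, h, ?_⟩
    rw [← cancel_mono F.m, Category.assoc, Category.assoc, hF, p.w,
      hZ.hom_ext (hZ.to F.I ≫ F.m) (hZ.to D)]
  refine ⟨F.I, F.e, IsCoker.of_desc (by rw [Category.assoc]; exact hz.precomp e) ?_⟩
  intro X y hy
  refine hq.desc y ?_
  obtain ⟨t, ht⟩ := hm.lift (kerι F.e) (by
    have := (isKer_kerι F.e).isZeroHom.comp F.m
    rwa [Category.assoc, hF] at this)
  have hmy : IsZeroHom (m ≫ y) := by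
    refine ⟨Z, hZ, h, ?_⟩
    rw [← cancel_epi e, ← Category.assoc e m y]
    exact (isZeroHom_of_isInitial hZ (e ≫ h) (hZ.to X)).eq hy |> (by simpa using ·)
  rw [← ht, Category.assoc]
  exact hmy.precomp t

/-- The cokernel object `Q[f]` of a proper morphism. -/
noncomputable def coker {A B : C} (f : A ⟶ B) (hf : IsProper f) : C :=
  hf.exists_isCoker.choose

/-- The cokernel morphism `B ⟶ Q[f]` of a proper morphism. -/
noncomputable def cokerπ {A B : C} (f : A ⟶ B) (hf : IsProper f) : B ⟶ coker f hf :=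
  hf.exists_isCoker.choose_spec.choose

theorem isCoker_cokerπ {A B : C} (f : A ⟶ B) (hf : IsProper f) : IsCoker f (cokerπ f hf) :=
  hf.exists_isCoker.choose_spec.choose_spec

instance {A B : C} (f : A ⟶ B) (hf : IsProper f) : Epi (cokerπ f hf) :=
  (isCoker_cokerπ f hf).epi

/-- The morphism out of the cokernel induced by `g` with `f ≫ g` zero. -/
noncomputable def cokerDesc {A B X : C} (f : A ⟶ B) (hf : IsProper f) (g : B ⟶ X)
    (h : IsZeroHom (f ≫ g)) : coker f hf ⟶ X :=
  ((isCoker_cokerπ f hf).desc g h).choose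

@[simp]
theorem cokerπ_desc {A B X : C} (f : A ⟶ B) (hf : IsProper f) (g : B ⟶ X)
    (h : IsZeroHom (f ≫ g)) : cokerπ f hf ≫ cokerDesc f hf g h = g :=
  ((isCoker_cokerπ f hf).desc g h).choose_spec

/-- A proper morphism `f` with `f ≫ g` zero remains proper as a morphism to the kernel of `g`. -/
theorem IsProper.kerLift {A B D : C} {f : A ⟶ B} (hf : IsProper f) (g : B ⟶ D)
    (h : IsZeroHom (f ≫ g)) : IsProper (kerLift g f h) := by
  obtain ⟨I, e, m, he, rfl, E, y, hm⟩ := hf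
  have : Epi e := inferInstance
  have := hm.mono
  obtain ⟨Z, hZ, z, p⟩ := id hm
  have hmg : IsZeroHom (m ≫ g) := by
    refine ⟨Z, hZ, z, ?_⟩
    rw [← cancel_epi e, ← Category.assoc e m g]
    exact (isZeroHom_of_isInitial hZ (e ≫ z) (hZ.to D)).eq h |> (by simpa using ·)
  refine ⟨I, e, SemiAbelian.kerLift g m hmg, he, ?_, E, kerι g ≫ y, ?_⟩
  · rw [← cancel_mono (kerι g)]; simp
  · have : Mono (SemiAbelian.kerLift g m hmg) := mono_of_mono_fac (kerLift_ι g m hmg)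
    refine IsKer.of_lift ?_ ?_
    · rw [← Category.assoc, kerLift_ι]; exact hm.isZeroHom
    · intro X x hx
      obtain ⟨t, ht⟩ := hm.lift (x ≫ kerι g) (by simpa using hx)
      exact ⟨t, by rw [← cancel_mono (kerι g), Category.assoc, kerLift_ι, ht]⟩

end Cokernels

/-! ### Positively graded chain complexes -/

/-- A positively graded chain complex: objects `X n` for `n : ℕ` and boundary operators
`d n : X (n + 1) ⟶ X n` such that the composite of two consecutive ones is zero. -/
structure PosChainComplex (C : Type u) [Category.{v} C] where
  X : ℕ → C
  d : ∀ n, X (n + 1) ⟶ X n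
  d_comp_d : ∀ n, IsZeroHom (d (n + 1) ≫ d n)

namespace PosChainComplex

variable {C : Type u} [Category.{v} C]

/-- Morphisms of chain complexes are commutative ladders. -/
@[ext]
structure Hom (K L : PosChainComplex C) where
  f : ∀ n, K.X n ⟶ L.X n
  comm : ∀ n, f (n + 1) ≫ L.d n = K.d n ≫ f n

attribute [simp] Hom.comm

instance : Category (PosChainComplex C) where
  Hom K L := Hom K L
  id K := { f := fun n => 𝟙 (K.X n), comm := by simp }
  comp φ ψ := { f := fun n => φ.f n ≫ ψ.f n, comm := fun n => by
                  rw [Category.assoc, ψ.comm, ← Category.assoc, φ.comm, Category.assoc] }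

@[ext]
theorem hom_ext {K L : PosChainComplex C} {φ ψ : K ⟶ L} (h : ∀ n, φ.f n = ψ.f n) : φ = ψ :=
  Hom.ext (funext h)

@[simp] theorem id_f (K : PosChainComplex C) (n : ℕ) : Hom.f (𝟙 K) n = 𝟙 (K.X n) := rfl

@[simp] theorem comp_f {K L M : PosChainComplex C} (φ : K ⟶ L) (ψ : L ⟶ M) (n : ℕ) :
    (φ ≫ ψ).f n = φ.f n ≫ ψ.f n := rfl

variable (C) in
/-- A chain complex is proper when all its boundary operators are proper morphisms. -/
def isProper : ObjectProperty (PosChainComplex C) := fun K => ∀ n, IsProper (K.d n)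

end PosChainComplex

/-- The category of proper positively graded chain complexes, a full subcategory of the category
of positively graded chain complexes. -/
abbrev ProperChainComplex (C : Type u) [Category.{v} C] :=
  (PosChainComplex.isProper C).FullSubcategory

/-! ### Homology of proper chain complexes -/

section Homology

variable {C : Type u} [Category.{v} C] [Sequentiable C]

namespace PosChainComplex

/-- `K[d_n]`, the kernel of the boundary operator going out of degree `n`,
for `n > 0`; the whole object for `n = 0`. -/
noncomputable def cycles (K : PosChainComplex C) : ℕ → C
  | 0 => K.X 0
  | n + 1 => ker (K.d n)

/-- The canonical monomorphism from the cycles to the complex. -/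
noncomputable def cyclesι (K : PosChainComplex C) : ∀ n, K.cycles n ⟶ K.X n
  | 0 => 𝟙 _
  | n + 1 => kerι (K.d n)

instance (K : PosChainComplex C) (n : ℕ) : Mono (K.cyclesι n) := by
  cases n with
  | zero => exact inferInstanceAs (Mono (𝟙 (K.X 0)))
  | succ n => exact inferInstanceAs (Mono (kerι (K.d n)))

/-- The boundary operator as a morphism to the cycles. -/
noncomputable def toCycles (K : PosChainComplex C) : ∀ n, K.X (n + 1) ⟶ K.cycles n
  | 0 => K.d 0
  | n + 1 => kerLift (K.d n) (K.d (n + 1)) (K.d_comp_d n)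

@[simp]
theorem toCycles_ι (K : PosChainComplex C) (n : ℕ) : K.toCycles n ≫ K.cyclesι n = K.d n := by
  cases n with
  | zero => exact Category.comp_id _
  | succ n => exact kerLift_ι _ _ (K.d_comp_d n)

theorem isProper_toCycles (K : PosChainComplex C) (hK : isProper C K) (n : ℕ) :
    IsProper (K.toCycles n) := by
  cases n with
  | zero => exact hK 0
  | succ n => exact (hK (n + 1)).kerLift _ (K.d_comp_d n)

/-- The morphism induced on cycles. -/
noncomputable def cyclesMap {K L : PosChainComplex C} (φ : K ⟶ L) :
    ∀ n, K.cycles n ⟶ L.cycles n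
  | 0 => φ.f 0
  | n + 1 => kerMap (φ.comm n)

@[simp]
theorem cyclesMap_ι {K L : PosChainComplex C} (φ : K ⟶ L) (n : ℕ) :
    cyclesMap φ n ≫ L.cyclesι n = K.cyclesι n ≫ φ.f n := by
  cases n with
  | zero => exact (Category.comp_id _).trans (Category.id_comp _).symm
  | succ n => exact kerMap_ι (φ.comm n)

theorem toCycles_map {K L : PosChainComplex C} (φ : K ⟶ L) (n : ℕ) :
    K.toCycles n ≫ cyclesMap φ n = φ.f (n + 1) ≫ L.toCycles n := by
  rw [← cancel_mono (L.cyclesι n)]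
  simp only [Category.assoc, cyclesMap_ι, toCycles_ι, Hom.comm]
  rw [← Category.assoc, toCycles_ι]

end PosChainComplex

namespace PosChainComplex

theorem cyclesMap_id (K : PosChainComplex C) (n : ℕ) : cyclesMap (𝟙 K) n = 𝟙 _ := by
  rw [← cancel_mono (K.cyclesι n)]; simp

theorem cyclesMap_comp {K L M : PosChainComplex C} (φ : K ⟶ L) (ψ : L ⟶ M) (n : ℕ) :
    cyclesMap (φ ≫ ψ) n = cyclesMap φ n ≫ cyclesMap ψ n := by
  rw [← cancel_mono (M.cyclesι n), Category.assoc, cyclesMap_ι, cyclesMap_ι, ← Category.assoc,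
    cyclesMap_ι, Category.assoc, comp_f]

end PosChainComplex

open PosChainComplex in
/-- The `n`-th homology functor on proper chain complexes: `H_n K` is the cokernel of
`K_{n+1} ⟶ K[d_n]` for `n > 0` and the cokernel of `K_1 ⟶ K_0` for `n = 0`. -/
noncomputable def homology (n : ℕ) : ProperChainComplex C ⥤ C where
  obj K := coker (K.obj.toCycles n) (isProper_toCycles K.obj K.property n)
  map {K L} φ := cokerDesc _ _ (cyclesMap φ.hom n ≫ cokerπ _ _) (by
    rw [← Category.assoc, toCycles_map, Category.assoc]
    exact (isCoker_cokerπ (L.obj.toCycles n)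
      (isProper_toCycles L.obj L.property n)).isZeroHom.precomp _)
  map_id K := by
    rw [← cancel_epi (cokerπ _ _), cokerπ_desc, Category.comp_id]
    exact (congrArg (· ≫ cokerπ _ _) (cyclesMap_id K.obj n)).trans (Category.id_comp _)
  map_comp φ ψ := by
    rw [← cancel_epi (cokerπ _ _), cokerπ_desc, ← Category.assoc, cokerπ_desc, Category.assoc,
      cokerπ_desc, ← Category.assoc]
    exact congrArg (· ≫ cokerπ _ _) (cyclesMap_comp φ.hom ψ.hom n)

end Homology

/-! ### The Moore complex -/

/-- The object `A_n` of a simplicial object `A`. -/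
abbrev deg {C : Type u} [Category.{v} C] (A : SimplicialObject C) (n : ℕ) : C :=
  A.obj (.op (.mk n))

section Moore

variable {C : Type u} [Category.{v} C] [HasFiniteLimits C]

namespace Moore

/-- The morphism `(∂_0, …, ∂_n) : A_{n+1} ⟶ (A_n)^{n+1}` (all faces but the last one). -/
noncomputable def faces (A : SimplicialObject C) (n : ℕ) :
    deg A (n + 1) ⟶ ∏ᶜ fun _ : Fin (n + 1) => deg A n :=
  Pi.lift fun i : Fin (n + 1) => A.δ i.castSucc

theorem faces_naturality {A B : SimplicialObject C} (φ : A ⟶ B) (n : ℕ) :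
    φ.app (.op (.mk (n + 1))) ≫ faces B n =
      faces A n ≫ Limits.Pi.map fun _ : Fin (n + 1) => φ.app (.op (.mk n)) := by
  refine Pi.hom_ext _ _ fun i => ?_
  simp [faces, SimplicialObject.δ_naturality]

variable [QuasiPointed C]

/-- The objects of the Moore complex: `N_0 A = A_0` and `N_{n+1} A` is the kernel of
`(∂_0, …, ∂_n) : A_{n+1} ⟶ (A_n)^{n+1}`, i.e. the intersection of the kernels of
`∂_0, …, ∂_n : A_{n+1} ⟶ A_n`. -/
noncomputable def obj (A : SimplicialObject C) : ℕ → C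
  | 0 => deg A 0
  | n + 1 => ker (faces A n)

/-- The canonical monomorphism `N_n A ⟶ A_n`. -/
noncomputable def ι (A : SimplicialObject C) : ∀ n, obj A n ⟶ deg A n
  | 0 => 𝟙 _
  | n + 1 => kerι (faces A n)

instance (A : SimplicialObject C) (n : ℕ) : Mono (ι A n) := by
  cases n with
  | zero => exact inferInstanceAs (Mono (𝟙 (deg A 0)))
  | succ n => exact inferInstanceAs (Mono (kerι (faces A n)))

theorem isZeroHom_comp_faces {A : SimplicialObject C} {n : ℕ} {X : C} (x : X ⟶ deg A (n + 1))
    (h : ∀ i : Fin (n + 1), IsZeroHom (x ≫ A.δ i.castSucc)) : IsZeroHom (x ≫ faces A n) := by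
  obtain ⟨t, _⟩ := (h 0).lift (initialIsInitial (C := C))
  refine ⟨⊥_ C, initialIsInitial, t, ?_⟩
  refine Pi.hom_ext _ _ fun i => ?_
  have h₁ : (x ≫ faces A n) ≫ Pi.π _ i = x ≫ A.δ i.castSucc := by simp [faces]
  rw [h₁, Category.assoc]
  exact (isZeroHom_of_isInitial initialIsInitial _ _).eq (h i)

theorem isZeroHom_ι_δ (A : SimplicialObject C) (n : ℕ) (i : Fin (n + 1)) :
    IsZeroHom (ι A (n + 1) ≫ A.δ i.castSucc) := by
  have h : IsZeroHom ((ι A (n + 1) ≫ faces A n) ≫ Pi.π _ i) :=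
    (isKer_kerι (faces A n)).isZeroHom.comp _
  simpa [faces] using h

theorem isZeroHom_ι_δ_last (A : SimplicialObject C) (n : ℕ) :
    IsZeroHom ((ι A (n + 2) ≫ A.δ (Fin.last (n + 2))) ≫ faces A n) := by
  refine isZeroHom_comp_faces _ fun i => ?_
  have h := A.δ_comp_δ (i := i.castSucc) (j := Fin.last (n + 1)) (Fin.le_last _)
  rw [Category.assoc, ← Fin.succ_last, h, ← Category.assoc]
  exact (isZeroHom_ι_δ A (n + 1) i.castSucc).comp _

/-- The boundary operators of the Moore complex, induced by the last face operators. -/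
noncomputable def d (A : SimplicialObject C) : ∀ n, obj A (n + 1) ⟶ obj A n
  | 0 => ι A 1 ≫ A.δ (Fin.last 1)
  | n + 1 => kerLift (faces A n) (ι A (n + 2) ≫ A.δ (Fin.last (n + 2))) (isZeroHom_ι_δ_last A n)

@[simp]
theorem d_ι (A : SimplicialObject C) (n : ℕ) :
    d A n ≫ ι A n = ι A (n + 1) ≫ A.δ (Fin.last (n + 1)) := by
  cases n with
  | zero => exact Category.comp_id _
  | succ n => exact kerLift_ι _ _ (isZeroHom_ι_δ_last A n)

/-- The morphism induced in degree `n`. -/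
noncomputable def map {A B : SimplicialObject C} (φ : A ⟶ B) : ∀ n, obj A n ⟶ obj B n
  | 0 => φ.app (.op (.mk 0))
  | n + 1 => kerMap (faces_naturality φ n)

@[simp]
theorem map_ι {A B : SimplicialObject C} (φ : A ⟶ B) (n : ℕ) :
    map φ n ≫ ι B n = ι A n ≫ φ.app (.op (.mk n)) := by
  cases n with
  | zero => exact (Category.comp_id _).trans (Category.id_comp _).symm
  | succ n => exact kerMap_ι (faces_naturality φ n)

theorem d_comp_d (A : SimplicialObject C) (n : ℕ) : IsZeroHom (d A (n + 1) ≫ d A n) := by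
  refine IsZeroHom.of_comp_mono (m := ι A n) ?_
  have h := A.δ_comp_δ (i := Fin.last (n + 1)) (j := Fin.last (n + 1)) le_rfl
  rw [Category.assoc, d_ι, ← Category.assoc, d_ι, Category.assoc, ← Fin.succ_last, h,
    ← Category.assoc]
  exact (isZeroHom_ι_δ A (n + 1) (Fin.last (n + 1))).comp _

theorem map_comm {A B : SimplicialObject C} (φ : A ⟶ B) (n : ℕ) :
    map φ (n + 1) ≫ d B n = d A n ≫ map φ n := by
  rw [← cancel_mono (ι B n), Category.assoc, d_ι, ← Category.assoc, map_ι, Category.assoc,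
    ← SimplicialObject.δ_naturality, Category.assoc, map_ι, ← Category.assoc, ← Category.assoc, d_ι]

theorem map_id (A : SimplicialObject C) (n : ℕ) : map (𝟙 A) n = 𝟙 (obj A n) := by
  rw [← cancel_mono (ι A n)]; simp

theorem map_comp {A B D : SimplicialObject C} (φ : A ⟶ B) (ψ : B ⟶ D) (n : ℕ) :
    map (φ ≫ ψ) n = map φ n ≫ map ψ n := by
  rw [← cancel_mono (ι D n), Category.assoc, map_ι, map_ι, ← Category.assoc, map_ι,
    Category.assoc, NatTrans.comp_app]

end Moore

variable [QuasiPointed C]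

variable (C) in
/-- The normalization functor `N`, sending a simplicial object to its Moore complex. -/
noncomputable def normalization : SimplicialObject C ⥤ PosChainComplex C where
  obj A := { X := Moore.obj A, d := Moore.d A, d_comp_d := Moore.d_comp_d A }
  map φ := { f := Moore.map φ, comm := Moore.map_comm φ }
  map_id A := PosChainComplex.hom_ext (Moore.map_id A)
  map_comp φ ψ := PosChainComplex.hom_ext (Moore.map_comp φ ψ)

variable (C) in
/-- The normalization functor as a functor to proper chain complexes, provided that all Moore
complexes are proper. -/
noncomputable def properNormalization
    (h : ∀ A : SimplicialObject C, PosChainComplex.isProper C ((normalization C).obj A)) :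
    SimplicialObject C ⥤ ProperChainComplex C :=
  (PosChainComplex.isProper C).lift (normalization C) h

end Moore

/-! ### Kan fibrations -/

section Kan

variable {C : Type u} [Category.{v} C]

/-- An `(m + 1, k)`-horn of `A` with domain `X`: a family of morphisms `x_i : X ⟶ A_m`, for
`0 ≤ i ≤ m + 1` and `i ≠ k`, such that `∂_i x_j = ∂_{j-1} x_i` for all `i < j` different from `k`
(no condition if `m = 0`). -/
def IsHorn (A : SimplicialObject C) {X : C} :
    ∀ (m : ℕ) (k : Fin (m + 2)) (_ : ∀ i : Fin (m + 2), i ≠ k → (X ⟶ deg A m)), Prop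
  | 0, _, _ => True
  | m + 1, k, x => ∀ (i j : Fin (m + 2)) (_ : i ≤ j) (hi : i.castSucc ≠ k) (hj : j.succ ≠ k),
      x j.succ hj ≫ A.δ i = x i.castSucc hi ≫ A.δ j

/-- Kan fibrations between simplicial objects: relative to any horn, liftings exist after
composition with a regular epimorphism. -/
def IsKanFibration {A B : SimplicialObject C} (f : A ⟶ B) : Prop :=
  ∀ (m : ℕ) (k : Fin (m + 2)) (X : C) (x : ∀ i : Fin (m + 2), i ≠ k → (X ⟶ deg A m))
    (b : X ⟶ deg B (m + 1)), IsHorn A m k x →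
    (∀ (i : Fin (m + 2)) (hi : i ≠ k), b ≫ B.δ i = x i hi ≫ f.app (.op (.mk m))) →
    ∃ (Y : C) (p : Y ⟶ X) (a : Y ⟶ deg A (m + 1)), IsRegularEpi p ∧
      a ≫ f.app (.op (.mk (m + 1))) = p ≫ b ∧
      ∀ (i : Fin (m + 2)) (hi : i ≠ k), a ≫ A.δ i = p ≫ x i hi

end Kan

/-! ### The category of short exact sequences -/

/-- A short exact sequence `0 ⟶ X₁ ⟶ X₂ ⟶ X₃ ⟶ 1`. -/
structure ShortExactSeq (D : Type u) [Category.{v} D] where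
  {X₁ X₂ X₃ : D}
  k : X₁ ⟶ X₂
  f : X₂ ⟶ X₃
  exact : IsShortExact k f

/-- Morphisms of short exact sequences. -/
structure ShortExactSeq.Hom {D : Type u} [Category.{v} D] (S T : ShortExactSeq D) where
  τ₁ : S.X₁ ⟶ T.X₁
  τ₂ : S.X₂ ⟶ T.X₂
  τ₃ : S.X₃ ⟶ T.X₃
  comm_k : S.k ≫ τ₂ = τ₁ ≫ T.k
  comm_f : S.f ≫ τ₃ = τ₂ ≫ T.f

/-- Given functors `H n : D ⥤ E`, a natural long exact sequence
`⋯ ⟶ H_{n+1} X₃ ⟶ H_n X₁ ⟶ H_n X₂ ⟶ H_n X₃ ⟶ ⋯ ⟶ H_0 X₁ ⟶ H_0 X₂ ⟶ H_0 X₃ ⟶ 1`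
for short exact sequences in `D`, with connecting morphisms `δ`. It is exact at all objects but
`H_0 X₃`; there, the final `⟶ 1` means that `H_0 X₂ ⟶ H_0 X₃` is a regular epimorphism. -/
structure IsNaturalLongExact {D : Type*} [Category* D] {E : Type*} [Category* E] (H : ℕ → D ⥤ E)
    (δ : ∀ (n : ℕ) (S : ShortExactSeq D), (H (n + 1)).obj S.X₃ ⟶ (H n).obj S.X₁) : Prop where
  exact₁ : ∀ (n : ℕ) (S : ShortExactSeq D), IsExactAt (δ n S) ((H n).map S.k)
  exact₂ : ∀ (n : ℕ) (S : ShortExactSeq D), IsExactAt ((H n).map S.k) ((H n).map S.f)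
  exact₃ : ∀ (n : ℕ) (S : ShortExactSeq D), IsExactAt ((H (n + 1)).map S.f) (δ n S)
  regularEpi : ∀ S : ShortExactSeq D, IsRegularEpi ((H 0).map S.f)
  naturality : ∀ (n : ℕ) (S T : ShortExactSeq D) (φ : S.Hom T),
    δ n S ≫ (H n).map φ.τ₁ = (H (n + 1)).map φ.τ₃ ≫ δ n T

end SemiAbelian

open SemiAbelian

/-! Two consequences of protomodularity replace subtraction. A regular epimorphism is the cokernel
of its kernel (`isCoker_kerι`), so morphisms can be defined on quotients. And every relation is
difunctional: if a₁, a₂ agree under d and a₂, a₃ agree under t, there is a₄ with the d-value of a₃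
and the t-value of a₁. In a regular category this holds for any d and t, with no joint monicity,
once one passes to a regular epimorphic cover (`exists_difunctional_family`). When a₃ is zero, a₄
plays the role of a₁ − a₂.

Kan fibrations. A regular epimorphism of simplicial objects is one in each degree, so b lifts
locally to some a. The faces of a are then corrected one at a time: difunctionality produces a
substitute for a − σ∂_j a + σx_j, which has the right j-th face, the same image in B and the same
already correct faces (`HasPartialFiller.insert`).

Properness. N_{n+1}A ⟶ A_{n+1} is a kernel and ∂_{n+1} is a split epimorphism, so it suffices that
direct images of kernels along regular epimorphisms are kernels (`IsKer.exists_isKer_image`). The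
image of a kernel pair is reflexive, hence an equivalence relation by difunctionality, hence
effective by Barr exactness.

Exactness of N. Kernels are limits and are preserved. Filling the zero horn over an element of
N_{n+1}B lifts it locally to N_{n+1}A, so N turns regular epimorphisms into degreewise regular
epimorphisms, which are cokernels of their kernels.

Long exact sequence. This is the usual diagram chase on generalized elements, where each lift exists
after a regular epimorphic cover and differences are replaced by difunctionality. Properness
guarantees that a cycle with zero class is locally a boundary. -/

namespace SemiAbelian

/-! ### Difunctionality of relations in protomodular categories. -/

section Protomodularity

variable {C : Type u} [Category.{v} C]

/-- In a protomodular category, a subobject of the domain of a split epimorphism is everything as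
soon as it contains a section and the pullback along some morphism. -/
theorem isIso_of_mono_of_isPullback [Protomodular C] {T U V R M : C} {v : V ⟶ T} {ρ : V ⟶ R}
    {π : T ⟶ U} {u : R ⟶ U} (h : IsPullback v ρ π u) (m : M ⟶ T) [Mono m] (s : U ⟶ M)
    (hs : s ≫ m ≫ π = 𝟙 U) (j : V ⟶ M) (hj : j ≫ m = v) : IsIso m := by
  have left : IsPullback j ρ (m ≫ π) u := by
    refine ⟨⟨by rw [← Category.assoc, hj, h.w]⟩, ⟨PullbackCone.IsLimit.mk _
      (fun c => h.lift (c.fst ≫ m) c.snd (by simpa using c.condition)) ?_ ?_ ?_⟩⟩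
    · intro c
      rw [← cancel_mono m, Category.assoc, hj, h.lift_fst]
    · intro c
      exact h.lift_snd _ _ _
    · intro c w hw₁ hw₂
      refine h.hom_ext ?_ ?_
      · rw [h.lift_fst, ← hw₁, Category.assoc, hj]
      · rw [h.lift_snd, hw₂]
  have outer : IsPullback (j ≫ m) ρ π (u ≫ 𝟙 U) := by simpa [hj] using h
  -- Protomodularity cancels the left square and leaves `m` as a pullback of `𝟙 U`.
  have right := Protomodular.isPullback_right j m u (𝟙 U) ρ (m ≫ π) π ⟨⟨⟨s, hs⟩⟩⟩ ⟨by simp⟩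
    outer left
  exact right.isIso_fst_of_isIso

/-- Relations in a protomodular category are difunctional. -/
theorem JointlyMono.exists_difunctional [Protomodular C] [HasFiniteLimits C] {R D E : C}
    (d : R ⟶ D) (t : R ⟶ E) (hm : ∀ {Y : C} (f g : Y ⟶ R), f ≫ d = g ≫ d → f ≫ t = g ≫ t → f = g)
    {X : C} (a₁ a₂ a₃ : X ⟶ R) (h₁ : a₁ ≫ d = a₂ ≫ d) (h₂ : a₂ ≫ t = a₃ ≫ t) :
    ∃ a₄ : X ⟶ R, a₄ ≫ d = a₃ ≫ d ∧ a₄ ≫ t = a₁ ≫ t := by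
  -- `T` consists of triples (r₁, r₂, r₃) with d r₁ = d r₂ and t r₂ = t r₃; `π` forgets r₃ and `q`
  -- forgets r₁.
  let U := pullback d d
  let V := pullback t t
  let T := pullback (pullback.snd d d) (pullback.fst t t)
  let π : T ⟶ U := pullback.fst _ _
  let q : T ⟶ V := pullback.snd _ _
  -- The required pair (d r₃, t r₁). Its pullback along `y` is the subobject `m` of triples for
  -- which r₄ exists, and the aim is to show that `m` is invertible.
  let x : T ⟶ D ⨯ E := prod.lift (q ≫ pullback.snd t t ≫ d) (π ≫ pullback.fst d d ≫ t)
  let y : R ⟶ D ⨯ E := prod.lift d t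
  have hy : Mono y := ⟨fun f g e => hm f g
    (by simpa [y, prod.lift_fst] using congrArg (· ≫ prod.fst) e)
    (by simpa [y, prod.lift_snd] using congrArg (· ≫ prod.snd) e)⟩
  let m : pullback x y ⟶ T := pullback.fst x y
  let u : R ⟶ U := pullback.lift (𝟙 R) (𝟙 R) rfl
  have hu₁ : u ≫ pullback.fst d d = 𝟙 R := pullback.lift_fst _ _ _
  have hu₂ : u ≫ pullback.snd d d = 𝟙 R := pullback.lift_snd _ _ _
  let w : R ⟶ V := pullback.lift (𝟙 R) (𝟙 R) rfl
  have hw₁ : w ≫ pullback.fst t t = 𝟙 R := pullback.lift_fst _ _ _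
  have hw₂ : w ≫ pullback.snd t t = 𝟙 R := pullback.lift_snd _ _ _
  have hT : π ≫ pullback.snd d d = q ≫ pullback.fst t t := pullback.condition
  let v : V ⟶ T := pullback.lift (pullback.fst t t ≫ u) (𝟙 V) (by simp [hu₂])
  have hv₁ : v ≫ π = pullback.fst t t ≫ u := pullback.lift_fst _ _ _
  have hv₂ : v ≫ q = 𝟙 V := pullback.lift_snd _ _ _
  let s : U ⟶ T := pullback.lift (𝟙 U) (pullback.snd d d ≫ w) (by simp [hw₁])
  have hs₁ : s ≫ π = 𝟙 U := pullback.lift_fst _ _ _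
  have hs₂ : s ≫ q = pullback.snd d d ≫ w := pullback.lift_snd _ _ _
  have hpb : IsPullback v (pullback.fst t t) π u := by
    refine ⟨⟨hv₁⟩, ⟨PullbackCone.IsLimit.mk _ (fun c => c.fst ≫ q) ?_ ?_ ?_⟩⟩
    · intro c
      refine pullback.hom_ext ?_ ?_
      · change (((c.fst ≫ q) ≫ v) ≫ π) = c.fst ≫ π
        rw [Category.assoc, hv₁, c.condition, Category.assoc, ← reassoc_of% hT, c.condition_assoc,
          reassoc_of% hu₂]
      · change (((c.fst ≫ q) ≫ v) ≫ q) = c.fst ≫ q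
        rw [Category.assoc, hv₂, Category.comp_id]
    · intro c
      rw [Category.assoc, ← hT, c.condition_assoc, hu₂, Category.comp_id]
    · intro c l h₁ _
      rw [← h₁, Category.assoc, hv₂, Category.comp_id]
  -- On triples (r₁, r₂, r₂) one can take r₄ = r₁, and on triples (r₂, r₂, r₃) one can take r₄ = r₃.
  -- The former are a section of `π`, the latter its pullback along the diagonal `u`.
  have hsm : s ≫ x = pullback.fst d d ≫ y := by
    refine Limits.prod.hom_ext ?_ ?_
    · simp [x, y, prod.lift_fst, reassoc_of% hs₂, reassoc_of% hw₂, pullback.condition]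
    · simp [x, y, prod.lift_snd, reassoc_of% hs₁]
  have hvm : v ≫ x = pullback.snd t t ≫ y := by
    refine Limits.prod.hom_ext ?_ ?_
    · simp [x, y, prod.lift_fst, reassoc_of% hv₂]
    · simp [x, y, prod.lift_snd, reassoc_of% hv₁, reassoc_of% hu₁, pullback.condition]
  have hiso : IsIso m := isIso_of_mono_of_isPullback hpb m (pullback.lift s _ hsm)
    (by rw [← Category.assoc, pullback.lift_fst, hs₁]) (pullback.lift v _ hvm)
    (pullback.lift_fst _ _ _)
  let a : X ⟶ T := pullback.lift (pullback.lift a₁ a₂ h₁) (pullback.lift a₂ a₃ h₂)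
    (by simp [pullback.lift_fst, pullback.lift_snd])
  have ha₁ : a ≫ π = pullback.lift a₁ a₂ h₁ := pullback.lift_fst _ _ _
  have ha₂ : a ≫ q = pullback.lift a₂ a₃ h₂ := pullback.lift_snd _ _ _
  have e : (a ≫ inv m ≫ pullback.snd x y) ≫ y = a ≫ x := by
    have : m ≫ x = pullback.snd x y ≫ y := pullback.condition
    rw [Category.assoc, Category.assoc, ← this, IsIso.inv_hom_id_assoc]
  refine ⟨a ≫ inv m ≫ pullback.snd x y, ?_, ?_⟩
  · have := congrArg (· ≫ prod.fst) e
    simpa [x, y, prod.lift_fst, reassoc_of% ha₂, pullback.lift_snd_assoc] using this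
  · have := congrArg (· ≫ prod.snd) e
    simpa [x, y, prod.lift_snd, reassoc_of% ha₁, pullback.lift_fst_assoc] using this

end Protomodularity

/-! ### Local lifting and difunctionality in regular categories. -/

section RegularCategory

variable {C : Type u} [Category.{v} C]

theorem isRegularEpi_of_strongEpi [Regular C] {X Y : C} (f : X ⟶ Y) [StrongEpi f] :
    IsRegularEpi f := inferInstance

theorem _root_.CategoryTheory.IsRegularEpi.comp [Regular C] {X Y Z : C} {f : X ⟶ Y}
    {g : Y ⟶ Z} (hf : IsRegularEpi f) (hg : IsRegularEpi g) : IsRegularEpi (f ≫ g) :=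
  have := strongEpi_comp f g
  isRegularEpi_of_strongEpi _

theorem _root_.CategoryTheory.IsRegularEpi.of_comp [Regular C] {X Y Z : C} {f : X ⟶ Y} {g : Y ⟶ Z}
    (h : IsRegularEpi (f ≫ g)) : IsRegularEpi g :=
  have := strongEpi_of_strongEpi f g
  isRegularEpi_of_strongEpi _

theorem _root_.CategoryTheory.IsRegularEpi.of_isSplitEpi [Regular C] {X Y : C} (f : X ⟶ Y)
    [IsSplitEpi f] : IsRegularEpi f :=
  inferInstance

/-- Morphisms lift along regular epimorphisms after composition with a regular epimorphism. -/
theorem _root_.CategoryTheory.IsRegularEpi.exists_lift [Regular C] {A B X : C} {f : A ⟶ B}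
    (hf : IsRegularEpi f) (b : X ⟶ B) :
    ∃ (Y : C) (p : Y ⟶ X) (a : Y ⟶ A), IsRegularEpi p ∧ a ≫ f = p ≫ b :=
  ⟨_, pullback.snd f b, pullback.fst f b, inferInstance, pullback.condition⟩

theorem exists_isRegularEpi_mono_fac [Regular C] {A B : C} (f : A ⟶ B) :
    ∃ (I : C) (e : A ⟶ I) (m : I ⟶ B), IsRegularEpi e ∧ Mono m ∧ e ≫ m = f :=
  ⟨_, (Regular.strongEpiMonoFactorisation f).e, (Regular.strongEpiMonoFactorisation f).m,
    inferInstance, inferInstance, (Regular.strongEpiMonoFactorisation f).fac⟩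

/-- The Mal'tsev property of regular protomodular categories, in terms of generalized elements. -/
theorem exists_difunctional_family [Regular C] [Protomodular C] {ι : Type} [Finite ι] {A D : C}
    {E : ι → C} (d : A ⟶ D) (t : ∀ i, A ⟶ E i) {X : C} (a₁ a₂ a₃ : X ⟶ A)
    (h₁ : a₁ ≫ d = a₂ ≫ d) (h₂ : ∀ i, a₂ ≫ t i = a₃ ≫ t i) :
    ∃ (Y : C) (p : Y ⟶ X) (a₄ : Y ⟶ A), IsRegularEpi p ∧ a₄ ≫ d = p ≫ a₃ ≫ d ∧
      ∀ i, a₄ ≫ t i = p ≫ a₁ ≫ t i := by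
  -- The image of (d, t) is a genuine relation, hence difunctional; the element found there is
  -- lifted back along `e` at the cost of a cover.
  obtain ⟨I, e, m, he, hm, fac⟩ := exists_isRegularEpi_mono_fac (prod.lift d (Pi.lift t))
  have hd : e ≫ m ≫ prod.fst = d := by rw [reassoc_of% fac, prod.lift_fst]
  have ht : e ≫ m ≫ prod.snd = Pi.lift t := by rw [reassoc_of% fac, prod.lift_snd]
  obtain ⟨r, hr₁, hr₂⟩ := JointlyMono.exists_difunctional (m ≫ prod.fst) (m ≫ prod.snd)
    (fun f g hf hg => by
      rw [← cancel_mono m]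
      exact Limits.prod.hom_ext (by simpa using hf) (by simpa using hg))
    (a₁ ≫ e) (a₂ ≫ e) (a₃ ≫ e) (by simpa [hd] using h₁)
    (by
      simp only [Category.assoc, ht]
      exact Pi.hom_ext _ _ fun i => by simpa using h₂ i)
  obtain ⟨Y, p, a₄, hp, ha⟩ := he.exists_lift r
  refine ⟨Y, p, a₄, hp, ?_, fun i => ?_⟩
  · rw [← hd, reassoc_of% ha, hr₁, Category.assoc]
  · have hti : e ≫ m ≫ prod.snd ≫ Pi.π _ i = t i := by
      rw [← Category.assoc m, ← Category.assoc e, ht, Pi.lift_π]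
    rw [← hti, reassoc_of% ha]
    simpa using congrArg (fun w => p ≫ w ≫ Pi.π E i) hr₂

/-- The substitute for subtraction in the diagram chases: for zero `a₃`, the element `a₄` is killed
by `d` and agrees with `a₁` under `t`. -/
theorem exists_difunctional [Regular C] [Protomodular C] {A D E : C} (d : A ⟶ D) (t : A ⟶ E)
    {X : C} (a₁ a₂ a₃ : X ⟶ A) (h₁ : a₁ ≫ d = a₂ ≫ d) (h₂ : a₂ ≫ t = a₃ ≫ t) :
    ∃ (Y : C) (p : Y ⟶ X) (a₄ : Y ⟶ A), IsRegularEpi p ∧ a₄ ≫ d = p ≫ a₃ ≫ d ∧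
      a₄ ≫ t = p ≫ a₁ ≫ t := by
  obtain ⟨Y, p, a₄, hp, h, h'⟩ := exists_difunctional_family (ι := Unit) d (fun _ => t) a₁ a₂ a₃ h₁
    (fun _ => h₂)
  exact ⟨Y, p, a₄, hp, h, h' ()⟩

end RegularCategory

/-! ### Zero morphisms and exactness on generalized elements. -/

section ZeroMorphisms

variable {C : Type u} [Category.{v} C]

/-- In a quasi-pointed category a zero morphism out of `X` requires a morphism from `X` to an
initial object, which any given zero morphism out of `X` supplies. -/
theorem exists_isZeroHom [QuasiPointed C] {X Y : C} {f : X ⟶ Y} (hf : IsZeroHom f) (B : C) :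
    ∃ z : X ⟶ B, IsZeroHom z := by
  obtain ⟨Z, hZ, h, _⟩ := hf
  exact ⟨h ≫ hZ.to B, Z, hZ, h, rfl⟩

theorem mono_initialTo [QuasiPointed C] {Z : C} (hZ : IsInitial Z) (X : C) : Mono (hZ.to X) :=
  ⟨fun _ _ _ => hom_ext_of_isInitial hZ _ _⟩

/-- Morphisms are zero if they become so after composition with a strong epimorphism. -/
theorem IsZeroHom.of_strongEpi_comp [QuasiPointed C] {X Y B : C} {e : X ⟶ Y} [StrongEpi e]
    {f : Y ⟶ B} (h : IsZeroHom (e ≫ f)) : IsZeroHom f := by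
  obtain ⟨Z, hZ, z, hz⟩ := h
  have := mono_initialTo hZ B
  have sq : CommSq z e (hZ.to B) f := ⟨hz⟩
  exact ⟨Z, hZ, sq.lift, sq.fac_right⟩

/-- A cokernel of `f` is a coequalizer of `f` and the zero morphism `A ⟶ 0 ⟶ B`. -/
theorem IsCoker.isRegularEpi {A B Q : C} {f : A ⟶ B} {q : B ⟶ Q} (hq : IsCoker f q) :
    IsRegularEpi q := by
  obtain ⟨Z, hZ, h, p⟩ := hq
  have w : f ≫ q = (h ≫ hZ.to B) ≫ q := by
    rw [p.w, Category.assoc, hZ.hom_ext (hZ.to B ≫ q) (hZ.to Q)]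
  refine ⟨⟨⟨A, f, h ≫ hZ.to B, w, Cofork.IsColimit.mk _
    (fun s => p.desc s.π (hZ.to s.pt) ?_) (fun s => p.inl_desc _ _ _) ?_⟩⟩⟩
  · rw [s.condition, Category.assoc, hZ.hom_ext (hZ.to B ≫ s.π) (hZ.to s.pt)]
  · intro s l hl
    exact p.hom_ext (by rw [p.inl_desc]; exact hl) (hZ.hom_ext _ _)

/-- Exactness, in terms of generalized elements. -/
theorem IsExactAt.of_exists_lift [Regular C] [QuasiPointed C] {A B D : C} {f : A ⟶ B} {g : B ⟶ D}
    (hz : IsZeroHom (f ≫ g))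
    (hl : ∀ {X : C} (x : X ⟶ B), IsZeroHom (x ≫ g) →
      ∃ (Y : C) (p : Y ⟶ X) (y : Y ⟶ A), IsRegularEpi p ∧ y ≫ f = p ≫ x) :
    IsExactAt f g := by
  refine ⟨_, kerLift g f hz, kerι g, ?_, kerLift_ι _ _ _, isKer_kerι g⟩
  obtain ⟨Y, p, y, hp, e⟩ := hl (kerι g) (isKer_kerι g).isZeroHom
  have : y ≫ kerLift g f hz = p := by
    rw [← cancel_mono (kerι g), Category.assoc, kerLift_ι, e]
  exact IsRegularEpi.of_comp (f := y) (by rwa [this])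

theorem IsExactAt.exists_lift [Regular C] [QuasiPointed C] {A B D : C} {f : A ⟶ B} {g : B ⟶ D}
    (h : IsExactAt f g) {X : C} (x : X ⟶ B) (hx : IsZeroHom (x ≫ g)) :
    ∃ (Y : C) (p : Y ⟶ X) (y : Y ⟶ A), IsRegularEpi p ∧ y ≫ f = p ≫ x := by
  obtain ⟨I, e, m, he, rfl, hm⟩ := h
  obtain ⟨t, rfl⟩ := hm.lift x hx
  obtain ⟨Y, p, y, hp, e'⟩ := he.exists_lift t
  exact ⟨Y, p, y, hp, by rw [reassoc_of% e']⟩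

end ZeroMorphisms

/-! ### Cokernels of proper morphisms and direct images of kernels. -/

section Sequentiable

variable {C : Type u} [Category.{v} C] [Sequentiable C]

theorem IsKer.isCoker {K A B : C} {k : K ⟶ A} {e : A ⟶ B} (hk : IsKer k e) [IsRegularEpi e] :
    IsCoker k e := by
  have : Epi e := inferInstance
  refine IsCoker.of_desc hk.isZeroHom fun g hg => (isCoker_kerι e).desc g ?_
  obtain ⟨t, ht⟩ := hk.lift (kerι e) (isKer_kerι e).isZeroHom
  rw [← ht, Category.assoc]
  exact hg.precomp t

/-- The image of `f` is the kernel of some `g`, and `g` factors through the cokernel. Whatever the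
cokernel kills is therefore killed by `g` and lies in the image. -/
theorem IsProper.isExactAt_cokerπ {A B : C} {f : A ⟶ B} (hf : IsProper f) :
    IsExactAt f (cokerπ f hf) := by
  obtain ⟨I, e, m, he, fac, D, g, hm⟩ := id hf
  have := hm.mono
  refine ⟨I, e, m, he, fac, IsKer.of_lift ?_ fun x hx => hm.lift x ?_⟩
  · refine IsZeroHom.of_strongEpi_comp (e := e) ?_
    rw [reassoc_of% fac]
    exact (isCoker_cokerπ f hf).isZeroHom
  · obtain ⟨t, ht⟩ := (isCoker_cokerπ f hf).desc g (by
      rw [← fac, Category.assoc]; exact hm.isZeroHom.precomp e)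
    rw [← ht, ← Category.assoc]
    exact hx.comp t

/-- In an exact sequentiable category, the direct image of a kernel along a regular epimorphism is
a kernel. -/
theorem IsKer.exists_isKer_image [BarrExact C] {K A D B I : C} {k : K ⟶ A} {g : A ⟶ D}
    (hk : IsKer k g) {p : A ⟶ B} (hp : IsRegularEpi p) {e : K ⟶ I} {m : I ⟶ B}
    (he : IsRegularEpi e) [Mono m] (fac : e ≫ m = k ≫ p) : ∃ (Q : C) (q : B ⟶ Q), IsKer m q := by
  let R := pullback g g
  -- `P` is the direct image in `B ⨯ B` of the kernel pair of `g`.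
  obtain ⟨P, c, i, hc, hi, ci⟩ := exists_isRegularEpi_mono_fac
    (prod.lift (pullback.fst g g ≫ p) (pullback.snd g g ≫ p))
  let r₁ : P ⟶ B := i ≫ prod.fst
  let r₂ : P ⟶ B := i ≫ prod.snd
  have hc₁ : c ≫ r₁ = pullback.fst g g ≫ p := by simp [r₁, prod.lift_fst, reassoc_of% ci]
  have hc₂ : c ≫ r₂ = pullback.snd g g ≫ p := by simp [r₂, prod.lift_snd, reassoc_of% ci]
  have hjm : ∀ {Y : C} (x y : Y ⟶ P), x ≫ r₁ = y ≫ r₁ → x ≫ r₂ = y ≫ r₂ → x = y := by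
    intro Y x y h₁ h₂
    rw [← cancel_mono i]
    exact Limits.prod.hom_ext (by simpa [r₁] using h₁) (by simpa [r₂] using h₂)
  let dg : A ⟶ R := pullback.lift (𝟙 A) (𝟙 A) rfl
  -- Reflexivity: the diagonal of `B` factors through `P` because `p` is a strong epimorphism and
  -- `i` is monic.
  have sq : CommSq (dg ≫ c) p i (prod.lift (𝟙 B) (𝟙 B)) := ⟨by
    rw [Category.assoc, ci]
    refine Limits.prod.hom_ext ?_ ?_
    · simp [dg, pullback.lift_fst_assoc, prod.lift_fst]
    · simp [dg, pullback.lift_snd_assoc, prod.lift_snd]⟩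
  let s : B ⟶ P := sq.lift
  have hs : s ≫ i = prod.lift (𝟙 B) (𝟙 B) := sq.fac_right
  have hs₁ : s ≫ r₁ = 𝟙 B := by simp [r₁, prod.lift_fst, reassoc_of% hs]
  have hs₂ : s ≫ r₂ = 𝟙 B := by simp [r₂, prod.lift_snd, reassoc_of% hs]
  -- Symmetry: (b, b), (b, b'), (b', b') yield (b', b).
  obtain ⟨σ, hσ₁, hσ₂⟩ := JointlyMono.exists_difunctional r₁ r₂ hjm (r₁ ≫ s) (𝟙 P) (r₂ ≫ s)
    (by simp [hs₁]) (by simp [hs₂])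
  -- Transitivity: (b', b''), (b', b'), (b, b') yield (b, b'').
  obtain ⟨τ, hτ₁, hτ₂⟩ := JointlyMono.exists_difunctional r₁ r₂ hjm (pullback.snd r₂ r₁)
    (pullback.fst r₂ r₁ ≫ r₂ ≫ s) (pullback.fst r₂ r₁) (by simp [hs₁, pullback.condition])
    (by simp [hs₂])
  have heq : IsEquivalenceRelation r₁ r₂ := EquivalenceRelation.isEquivalenceRelation
    { right_cancellation := fun _ x y => hjm x y
      r := s
      reflexivity₁ := hs₁
      reflexivity₂ := hs₂
      s := σ
      symmetry₁ := by simpa [hs₁] using hσ₁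
      symmetry₂ := by simpa [hs₂] using hσ₂
      c := pullback.cone r₂ r₁
      isLimit := pullback.isLimit r₂ r₁
      t := τ
      transitivity₁ := hτ₁
      transitivity₂ := hτ₂ }
  obtain ⟨Q, q, hq⟩ := BarrExact.exists_isKernelPair r₁ r₂ heq
  have hpq : pullback.fst g g ≫ p ≫ q = pullback.snd g g ≫ p ≫ q := by
    rw [← reassoc_of% hc₁, ← reassoc_of% hc₂, hq.w]
  refine ⟨Q, q, IsKer.of_lift ?_ ?_⟩
  · refine IsZeroHom.of_strongEpi_comp (e := e) ?_
    obtain ⟨z, hz⟩ := exists_isZeroHom hk.isZeroHom A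
    have h := congrArg (pullback.lift k z (hk.isZeroHom.eq (hz.comp g)) ≫ ·) hpq
    simp only [pullback.lift_fst_assoc, pullback.lift_snd_assoc] at h
    rw [reassoc_of% fac, h]
    exact hz.comp _
  · intro X x hx
    obtain ⟨z, hz⟩ := exists_isZeroHom hx B
    have hr : x ≫ q = z ≫ q := hx.eq (hz.comp q)
    obtain ⟨Y, y, r, hy, e₁⟩ := hc.exists_lift (hq.lift x z hr)
    obtain ⟨z', hz'⟩ := exists_isZeroHom (hz.precomp y) A
    have hr₁ : r ≫ pullback.fst g g ≫ p = y ≫ x := by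
      rw [← hc₁, reassoc_of% e₁, hq.lift_fst]
    have hr₂ : r ≫ pullback.snd g g ≫ p = y ≫ z := by
      rw [← hc₂, reassoc_of% e₁, hq.lift_snd]
    -- Locally (x, 0) is the image of a pair (r₁, r₂) with g r₁ = g r₂ and p r₂ = 0. The element
    -- `a`, a substitute for r₁ − r₂, is killed by `g` and still lies over x.
    obtain ⟨Y', y', a, hy', ha₁, ha₂⟩ := exists_difunctional g p (r ≫ pullback.fst g g)
      (r ≫ pullback.snd g g) z' (by simp [pullback.condition])
      (by rw [Category.assoc, hr₂]; exact (hz.precomp y).eq (hz'.comp p))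
    obtain ⟨t, ht⟩ := hk.lift a (by rw [ha₁]; exact (hz'.comp g).precomp y')
    have hy'' : IsRegularEpi (y' ≫ y) := hy'.comp hy
    have sq : CommSq (t ≫ e) (y' ≫ y) m x := ⟨by
      rw [Category.assoc, fac, reassoc_of% ht, ha₂, Category.assoc, hr₁, Category.assoc]⟩
    exact ⟨sq.lift, sq.fac_right⟩

end Sequentiable

/-! ### Regular epimorphisms and kernels in functor categories. -/

section Pointwise

variable {C : Type u} [Category.{v} C] {J : Type*} [Category* J]

/-- Regular epimorphisms in a category of functors to a regular category are pointwise regular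
epimorphisms. -/
theorem isRegularEpi_app [Regular C] {A B : J ⥤ C} (f : A ⟶ B) [IsRegularEpi f] (j : J) :
    IsRegularEpi (f.app j) := by
  -- Kernel pairs are computed pointwise and have coequalizers in a regular category. Evaluation
  -- therefore preserves the coequalizer presenting `f`.
  have hk : ∀ j, HasColimit ((parallelPair (pullback.fst f f) (pullback.snd f f)).flip.obj j) := by
    intro j
    have hp : IsKernelPair (f.app j) ((pullback.fst f f).app j) ((pullback.snd f f).app j) :=
      (IsPullback.of_hasPullback f f).map ((evaluation J C).obj j)
    let F := (parallelPair (pullback.fst f f) (pullback.snd f f)).flip.obj j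
    have : HasColimit (parallelPair (F.map .left) (F.map .right)) :=
      Regular.hasCoequalizer_of_isKernelPair hp
    exact hasColimit_of_iso (diagramIsoParallelPair F)
  have hc := isColimitCoforkOfEffectiveEpi f (pullback.cone f f) (pullback.isLimit f f)
  have h := isColimitCoforkMapOfIsColimit ((evaluation J C).obj j) pullback.condition hc
  exact ⟨⟨Cofork.IsColimit.regularEpi h⟩⟩

theorem isKer_app [HasFiniteLimits C] [HasInitial C] {K A B : J ⥤ C} {k : K ⟶ A} {f : A ⟶ B}
    (h : IsKer k f) (j : J) : IsKer (k.app j) (f.app j) := by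
  obtain ⟨Z, hZ, z, p⟩ := h
  have hj : IsInitial (Z.obj j) := hZ.isInitialObj ((evaluation J C).obj j)
  refine ⟨Z.obj j, hj, z.app j, ?_⟩
  rw [hj.hom_ext (hj.to (B.obj j)) ((hZ.to B).app j)]
  exact p.map ((evaluation J C).obj j)

end Pointwise

/-! ### Filling horns one face at a time. -/

section Kan

variable {C : Type u} [Category.{v} C]

/-- If the face `∂_i a` is as prescribed by a horn, then replacing `∂_j a` by the value prescribed
by the horn does not change the `i`-th face of its degeneracy. -/
theorem IsHorn.comp_σ_δ {A : SimplicialObject C} {X Y : C} {m : ℕ} {k : Fin (m + 2)}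
    {x : ∀ i : Fin (m + 2), i ≠ k → (X ⟶ deg A m)} (hx : IsHorn A m k x) (p : Y ⟶ X)
    (a : Y ⟶ deg A (m + 1)) {i j : Fin (m + 2)} (hi : i ≠ k) (hj : j ≠ k)
    (ha : a ≫ A.δ i = p ≫ x i hi) (l : Fin (m + 1)) (hl : j = l.castSucc ∨ j = l.succ)
    (hil : i ≠ l.castSucc) (hil' : i ≠ l.succ) :
    (a ≫ A.δ j) ≫ A.σ l ≫ A.δ i = (p ≫ x j hj) ≫ A.σ l ≫ A.δ i := by
  obtain _ | m := m
  -- For m = 0 the faces `l.castSucc` and `l.succ` are the only two, so no `i` remains.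
  · exact absurd (show i = l.castSucc ∨ i = l.succ by
      simp only [Fin.ext_iff, Fin.val_castSucc, Fin.val_succ]; omega) (by simp [hil, hil'])
  -- In both cases the i-th face moves past the degeneracy. The resulting double face of `a` depends
  -- only on ∂_i a, which is prescribed, and the horn condition turns it into a face of x_j.
  by_cases h : i < l.castSucc
  · obtain ⟨i, rfl⟩ := Fin.exists_castSucc_eq.2 (show i ≠ Fin.last _ from
      (h.trans_le (Fin.le_last _)).ne)
    obtain ⟨l, rfl⟩ := Fin.exists_succ_eq.2 (show l ≠ 0 by rintro rfl; simp at h)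
    have hij : ∃ j', j = Fin.succ j' := by
      rcases hl with rfl | rfl
      · exact ⟨l.castSucc, by simp⟩
      · exact ⟨_, rfl⟩
    obtain ⟨j, rfl⟩ := hij
    have hij : i ≤ j := by
      simp only [Fin.ext_iff, Fin.lt_def, Fin.le_def, Fin.val_castSucc, Fin.val_succ] at *
      omega
    have hil : i ≤ l.castSucc := by
      simp only [Fin.lt_def, Fin.le_def, Fin.val_castSucc, Fin.val_succ] at *
      omega
    rw [A.δ_comp_σ_of_le hil, Category.assoc, ← Category.assoc (A.δ j.succ),
      A.δ_comp_δ hij, Category.assoc, reassoc_of% ha, Category.assoc,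
      ← Category.assoc (x _ hj), hx i j hij hi hj, Category.assoc]
  · have h' : l.succ < i := by
      simp only [Fin.ext_iff, ne_eq, Fin.lt_def, Fin.val_castSucc, Fin.val_succ] at *
      omega
    obtain ⟨i, rfl⟩ := Fin.exists_succ_eq.2 (show i ≠ 0 by rintro rfl; simp at h')
    obtain ⟨l, rfl⟩ := Fin.exists_castSucc_eq.2 (show l ≠ Fin.last _ by
      rintro rfl
      simp only [Fin.lt_def, Fin.val_succ, Fin.val_last] at h'
      omega)
    have hij : ∃ j', j = Fin.castSucc j' := by
      rcases hl with rfl | rfl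
      · exact ⟨_, rfl⟩
      · exact ⟨l.succ, by simp⟩
    obtain ⟨j, rfl⟩ := hij
    have hij : j ≤ i := by
      simp only [Fin.ext_iff, Fin.lt_def, Fin.le_def, Fin.val_castSucc, Fin.val_succ] at *
      omega
    have hil : l.castSucc < i := by
      simp only [Fin.lt_def, Fin.val_castSucc, Fin.val_succ] at *
      omega
    rw [A.δ_comp_σ_of_gt hil, Category.assoc, ← Category.assoc (A.δ j.castSucc),
      ← A.δ_comp_δ hij, Category.assoc, reassoc_of% ha, Category.assoc,
      ← Category.assoc (x _ hj), ← hx j i hij hj hi, Category.assoc]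

/-- Liftings along `f` exist, after composition with a regular epimorphism, which have the
prescribed boundary on the faces in `S`. -/
def HasPartialFiller {A B : SimplicialObject C} (f : A ⟶ B) {m : ℕ} {k : Fin (m + 2)} {X : C}
    (x : ∀ i : Fin (m + 2), i ≠ k → (X ⟶ deg A m)) (b : X ⟶ deg B (m + 1))
    (S : Set (Fin (m + 2))) : Prop :=
  ∃ (Y : C) (p : Y ⟶ X) (a : Y ⟶ deg A (m + 1)), IsRegularEpi p ∧
    a ≫ f.app (.op (.mk (m + 1))) = p ≫ b ∧
    ∀ (i : Fin (m + 2)) (hi : i ≠ k), i ∈ S → a ≫ A.δ i = p ≫ x i hi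

theorem HasPartialFiller.mono {A B : SimplicialObject C} {f : A ⟶ B} {m : ℕ} {k : Fin (m + 2)}
    {X : C} {x : ∀ i : Fin (m + 2), i ≠ k → (X ⟶ deg A m)} {b : X ⟶ deg B (m + 1)}
    {S T : Set (Fin (m + 2))} (h : HasPartialFiller f x b S) (hST : ∀ i ∈ T, i ≠ k → i ∈ S) :
    HasPartialFiller f x b T := by
  obtain ⟨Y, p, a, hp, ha, haS⟩ := h
  exact ⟨Y, p, a, hp, ha, fun i hi hiT => haS i hi (hST i hiT hi)⟩

variable [Regular C] [Protomodular C]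

/-- Difunctionality is applied to a, σ_l ∂_j a and σ_l x_j. The first two share their j-th face
since `l` is chosen with ∂_j σ_l = id; the last two share their image in `B` and their faces in `S`,
which avoid the two faces that cancel σ_l. -/
theorem HasPartialFiller.insert {A B : SimplicialObject C} {f : A ⟶ B} {m : ℕ} {k : Fin (m + 2)}
    {X : C} {x : ∀ i : Fin (m + 2), i ≠ k → (X ⟶ deg A m)} {b : X ⟶ deg B (m + 1)}
    {S : Set (Fin (m + 2))} (h : HasPartialFiller f x b S) (hx : IsHorn A m k x)
    (hb : ∀ (i : Fin (m + 2)) (hi : i ≠ k), b ≫ B.δ i = x i hi ≫ f.app (.op (.mk m)))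
    {j : Fin (m + 2)} (hj : j ≠ k) (l : Fin (m + 1)) (hl : j = l.castSucc ∨ j = l.succ)
    (hS : ∀ i ∈ S, i ≠ k → i ≠ l.castSucc ∧ i ≠ l.succ) :
    HasPartialFiller f x b (insert j S) := by
  obtain ⟨Y, p, a, hp, ha, haS⟩ := h
  have hσ : A.σ l ≫ A.δ j = 𝟙 _ := by
    rcases hl with rfl | rfl
    · exact A.δ_comp_σ_self
    · exact A.δ_comp_σ_succ
  -- The index `none` records the image in `B`, and `some i` the face ∂_i that is already correct.
  let E : Option {i // i ∈ S ∧ i ≠ k} → C := fun o =>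
    match o with
    | none => deg B (m + 1)
    | some _ => deg A m
  let t : ∀ o, deg A (m + 1) ⟶ E o := fun o =>
    match o with
    | none => f.app (.op (.mk (m + 1)))
    | some i => A.δ i.1
  obtain ⟨Y', q, a', hq, h₁, h₂⟩ := exists_difunctional_family (A.δ j) t a (a ≫ A.δ j ≫ A.σ l)
    (p ≫ x j hj ≫ A.σ l) (by simp [hσ]) (by
      rintro (_ | ⟨i, hi, hik⟩)
      · simp only [t, Category.assoc, SimplicialObject.σ_naturality]
        rw [SimplicialObject.δ_naturality_assoc, reassoc_of% ha, ← reassoc_of% (hb j hj)]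
      · simpa only [t, Category.assoc] using
          hx.comp_σ_δ p a hik hj (haS i hik hi) l hl (hS i hi hik).1 (hS i hi hik).2)
  refine ⟨Y', q ≫ p, a', hq.comp hp, ?_, ?_⟩
  · rw [show a' ≫ f.app (.op (.mk (m + 1))) = _ from h₂ none]
    simp only [t]
    rw [ha, Category.assoc]
  · rintro i hi (rfl | hiS)
    · rw [h₁, Category.assoc, Category.assoc, hσ, Category.comp_id, Category.assoc]
    · rw [show a' ≫ A.δ i = _ from h₂ (some ⟨i, hiS, hi⟩)]
      simp only [t]
      rw [haS i hi hiS, Category.assoc]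

/-- In a regular protomodular category, pointwise regular epimorphisms of simplicial objects are
Kan fibrations. -/
theorem isKanFibration_of_isRegularEpi_app {A B : SimplicialObject C} (f : A ⟶ B)
    (hf : ∀ n : ℕ, IsRegularEpi (f.app (.op (.mk n)))) : IsKanFibration f := by
  intro m k X x b hx hb
  -- Faces below `k` are corrected upwards, using σ_n for the face n: the faces n and n + 1
  -- cancelled by σ_n are not yet among the corrected ones.
  have h₁ : ∀ n : ℕ, n ≤ k.val → HasPartialFiller f x b {i | i.val < n} := by
    intro n
    induction n with
    | zero =>
      intro _
      obtain ⟨Y, p, a, hp, ha⟩ := (hf (m + 1)).exists_lift b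
      exact ⟨Y, p, a, hp, ha, fun i _ hi => absurd hi (Nat.not_lt_zero _)⟩
    | succ n ih =>
      intro hn
      have hnm : n < m + 1 := by omega
      refine ((ih (by omega)).insert hx hb (j := ⟨n, by omega⟩)
        (by simp only [ne_eq, Fin.ext_iff]; omega) ⟨n, hnm⟩
        (Or.inl rfl) ?_).mono ?_
      · intro i hi _
        simp only [Set.mem_ofPred_eq, ne_eq, Fin.ext_iff, Fin.val_castSucc, Fin.val_succ] at *
        omega
      · intro i hi _
        simp only [Set.mem_ofPred_eq, Set.mem_insert_iff, Fin.ext_iff] at *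
        omega
  -- Faces above `k` are corrected downwards from m + 1, now using σ_{j-1} for the face j. As j − 1
  -- ≥ k, the faces below `k` are not disturbed.
  have h₂ : ∀ n : ℕ, n + k.val ≤ m + 1 →
      HasPartialFiller f x b {i | i.val < k.val ∨ m + 1 < i.val + n} := by
    intro n
    induction n with
    | zero =>
      intro _
      refine (h₁ k.val le_rfl).mono fun i hi _ => ?_
      simp only [Set.mem_ofPred_eq] at *
      omega
    | succ n ih =>
      intro hn
      refine ((ih (by omega)).insert hx hb (j := ⟨m + 1 - n, by omega⟩)
        (by simp only [ne_eq, Fin.ext_iff]; omega) ⟨m - n, by omega⟩ (Or.inr ?_) ?_).mono ?_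
      · simp only [Fin.ext_iff, Fin.val_succ]
        omega
      · intro i hi _
        simp only [Set.mem_ofPred_eq, ne_eq, Fin.ext_iff, Fin.val_castSucc, Fin.val_succ] at *
        omega
      · intro i hi _
        simp only [Set.mem_ofPred_eq, Set.mem_insert_iff, Fin.ext_iff] at *
        omega
  obtain ⟨Y, p, a, hp, ha, hS⟩ := h₂ (m + 1 - k.val) (by omega)
  refine ⟨Y, p, a, hp, ha, fun i hi => hS i hi ?_⟩
  have : i.val ≠ k.val := fun h => hi (Fin.ext h)
  simp only [Set.mem_ofPred_eq]
  omega

theorem isKanFibration_of_isRegularEpi {A B : SimplicialObject C} (f : A ⟶ B)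
    (hf : IsRegularEpi f) : IsKanFibration f :=
  isKanFibration_of_isRegularEpi_app f fun _ => isRegularEpi_app f _

end Kan

/-! ### Degreewise kernels and cokernels of chain complexes. -/

namespace PosChainComplex

variable {C : Type u} [Category.{v} C] [QuasiPointed C]

variable (C) in
/-- The complex whose objects are all initial. -/
noncomputable def zero : PosChainComplex C where
  X _ := ⊥_ C
  d _ := 𝟙 _
  d_comp_d _ := ⟨⊥_ C, initialIsInitial, 𝟙 _, initialIsInitial.hom_ext _ _⟩

variable (C) in
/-- The complex of initial objects is initial. -/
noncomputable def isInitialZero : IsInitial (zero C) :=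
  IsInitial.ofUniqueHom
    (fun K => { f := fun n => initial.to (K.X n), comm := fun _ => initialIsInitial.hom_ext _ _ })
    (fun _ _ => hom_ext fun _ => initialIsInitial.hom_ext _ _)

/-- A complex whose objects admit morphisms to an initial object maps to the zero complex. -/
noncomputable def toZero (K : PosChainComplex C) (h : ∀ n, Nonempty (K.X n ⟶ ⊥_ C)) :
    K ⟶ zero C :=
  { f := fun n => (h n).some, comm := fun _ => hom_ext_of_isInitial initialIsInitial _ _ }

theorem nonempty_hom_initial {X Y : C} {f : X ⟶ Y} (h : IsZeroHom f) : Nonempty (X ⟶ ⊥_ C) :=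
  ⟨(h.lift initialIsInitial).choose⟩

/-- Kernels of complexes can be computed in each degree. -/
theorem isKer_of_f {K L M : PosChainComplex C} {φ : K ⟶ L} {ψ : L ⟶ M}
    (h : ∀ n, IsKer (φ.f n) (ψ.f n)) : IsKer φ ψ := by
  have hm := fun n => (h n).mono
  have hz : ∀ {P : PosChainComplex C} (x : P ⟶ L) (z : P ⟶ zero C),
      x ≫ ψ = z ≫ (isInitialZero C).to M → ∀ n, IsZeroHom (x.f n ≫ ψ.f n) := by
    intro P x z e n
    rw [← comp_f, e]
    exact isZeroHom_of_isInitial initialIsInitial (z.f n) _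
  refine ⟨zero C, isInitialZero C, toZero K fun n => nonempty_hom_initial (h n).isZeroHom,
    ⟨⟨hom_ext fun n => ?_⟩, ⟨PullbackCone.IsLimit.mk _
      (fun s => { f := fun n => ((h n).lift _ (hz s.fst s.snd s.condition n)).choose,
                  comm := fun n => ?_ }) (fun s => hom_ext fun n => ?_)
      (fun s => hom_ext fun n => hom_ext_of_isInitial initialIsInitial _ _)
      (fun s l hl _ => hom_ext fun n => ?_)⟩⟩⟩
  · exact (h n).isZeroHom.eq (isZeroHom_of_isInitial initialIsInitial _ _)
  · have h₁ := ((h (n + 1)).lift _ (hz s.fst s.snd s.condition (n + 1))).choose_spec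
    have h₂ := ((h n).lift _ (hz s.fst s.snd s.condition n)).choose_spec
    rw [← cancel_mono (φ.f n), Category.assoc, ← φ.comm, ← Category.assoc, h₁, Category.assoc, h₂,
      s.fst.comm]
  · exact ((h n).lift _ (hz s.fst s.snd s.condition n)).choose_spec
  · rw [← cancel_mono (φ.f n)]
    exact (congrArg (fun w => Hom.f w n) hl).trans
      ((h n).lift _ (hz s.fst s.snd s.condition n)).choose_spec.symm

/-- Cokernels of complexes can be computed in each degree. -/
theorem isCoker_of_f {K L M : PosChainComplex C} {φ : K ⟶ L} {ψ : L ⟶ M}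
    (h : ∀ n, IsCoker (φ.f n) (ψ.f n)) : IsCoker φ ψ := by
  have hm := fun n => (h n).epi
  have hz : ∀ {P : PosChainComplex C} (t : K ⟶ zero C) (x : L ⟶ P) (z : zero C ⟶ P),
      φ ≫ x = t ≫ z → ∀ n, IsZeroHom (φ.f n ≫ x.f n) := by
    intro P t x z e n
    rw [← comp_f, e]
    exact isZeroHom_of_isInitial initialIsInitial (t.f n) _
  let t := toZero K fun n => nonempty_hom_initial (h n).isZeroHom
  refine ⟨zero C, isInitialZero C, t,
    ⟨⟨hom_ext fun n => ?_⟩, ⟨PushoutCocone.IsColimit.mk _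
      (fun s => { f := fun n => ((h n).desc _ (hz t s.inl s.inr s.condition n)).choose,
                  comm := fun n => ?_ }) (fun s => hom_ext fun n => ?_)
      (fun s => (isInitialZero C).hom_ext _ _)
      (fun s l hl _ => hom_ext fun n => ?_)⟩⟩⟩
  · exact (h n).isZeroHom.eq (isZeroHom_of_isInitial initialIsInitial _ _)
  · have h₁ := ((h (n + 1)).desc _ (hz t s.inl s.inr s.condition (n + 1))).choose_spec
    have h₂ := ((h n).desc _ (hz t s.inl s.inr s.condition n)).choose_spec
    rw [← cancel_epi (ψ.f (n + 1)), ← Category.assoc, h₁, ← Category.assoc, ψ.comm, Category.assoc,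
      h₂, s.inl.comm]
  · exact ((h n).desc _ (hz t s.inl s.inr s.condition n)).choose_spec
  · rw [← cancel_epi (ψ.f n)]
    exact (congrArg (fun w => Hom.f w n) hl).trans
      ((h n).desc _ (hz t s.inl s.inr s.condition n)).choose_spec.symm

end PosChainComplex

/-! ### Properness of Moore complexes and exactness of normalization. -/

section Moore

variable {C : Type u} [Category.{v} C]

theorem IsKer.of_comp_of_mono [QuasiPointed C] {K A B D : C} {m : K ⟶ A} {i : A ⟶ B} [Mono i]
    {q : B ⟶ D} (h : IsKer (m ≫ i) q) : IsKer m (i ≫ q) :=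
  have := h.mono
  have : Mono m := mono_of_mono m i
  IsKer.of_lift (by simpa using h.isZeroHom) fun g hg => by
    obtain ⟨t, ht⟩ := h.lift (g ≫ i) (by simpa using hg)
    exact ⟨t, by rw [← cancel_mono i, Category.assoc, ht]⟩

theorem Moore.isKer_ι [HasFiniteLimits C] [QuasiPointed C] (A : SimplicialObject C) (n : ℕ) :
    IsKer (Moore.ι A (n + 1)) (faces A n) := isKer_kerι (faces A n)

/-- The boundary operators of Moore complexes in an exact sequentiable category are proper. -/
theorem Moore.isProper_d [Sequentiable C] [BarrExact C] (A : SimplicialObject C) (n : ℕ) :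
    IsProper (Moore.d A n) := by
  obtain ⟨I, e, m, he, hm, fac⟩ := exists_isRegularEpi_mono_fac (Moore.d A n)
  have hp : IsSplitEpi (A.δ (Fin.last (n + 1))) :=
    ⟨⟨⟨A.σ (Fin.last n), by rw [← Fin.succ_last]; exact A.δ_comp_σ_succ⟩⟩⟩
  -- The image of `Moore.d A n`, seen inside A_n, is the direct image of the kernel N_{n+1}A along
  -- the last face; restricting `q` to N_nA exhibits it as a kernel there.
  obtain ⟨Q, q, hq⟩ := (Moore.isKer_ι A n).exists_isKer_image
    (IsRegularEpi.of_isSplitEpi (A.δ (Fin.last (n + 1)))) (m := m ≫ Moore.ι A n) he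
    (by rw [← Category.assoc, fac, Moore.d_ι])
  exact ⟨I, e, m, he, fac, Q, _, hq.of_comp_of_mono⟩

/-- Normalization preserves kernels. -/
theorem Moore.isKer_map [HasFiniteLimits C] [QuasiPointed C] {K A B : SimplicialObject C}
    {φ : K ⟶ A} {f : A ⟶ B} (h : ∀ n : ℕ, IsKer (φ.app (.op (.mk n))) (f.app (.op (.mk n))))
    (n : ℕ) : IsKer (Moore.map φ n) (Moore.map f n) := by
  have hm := fun n => (h n).mono
  have : Mono (Moore.map φ n) := by
    have : Mono (Moore.map φ n ≫ Moore.ι A n) := by rw [Moore.map_ι]; infer_instance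
    exact mono_of_mono _ (Moore.ι A n)
  refine IsKer.of_lift (IsZeroHom.of_comp_mono (m := Moore.ι B n) ?_) fun {X} g hg => ?_
  · rw [Category.assoc, Moore.map_ι, ← Category.assoc, Moore.map_ι, Category.assoc]
    exact (h n).isZeroHom.precomp _
  obtain ⟨t, ht⟩ := (h n).lift (g ≫ Moore.ι A n) (by
    rw [Category.assoc, ← Moore.map_ι, ← Category.assoc]
    exact hg.comp _)
  obtain ⟨s, hs⟩ : ∃ s : X ⟶ Moore.obj K n, s ≫ Moore.ι K n = t := by
    obtain _ | n := n
    · exact ⟨t, Category.comp_id _⟩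
    · refine ⟨kerLift (faces K n) t (isZeroHom_comp_faces t fun i => ?_), kerLift_ι _ _ _⟩
      refine IsZeroHom.of_comp_mono (m := φ.app (.op (.mk n))) ?_
      rw [Category.assoc, SimplicialObject.δ_naturality, reassoc_of% ht]
      exact (Moore.isZeroHom_ι_δ A n i).precomp g
  exact ⟨s, by rw [← cancel_mono (Moore.ι A n), Category.assoc, Moore.map_ι, reassoc_of% hs, ht]⟩

/-- Normalization sends Kan fibrations that are regular epimorphisms in degree zero to degreewise
regular epimorphisms. -/
theorem Moore.isRegularEpi_map [Regular C] [QuasiPointed C] {A B : SimplicialObject C} {f : A ⟶ B}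
    (hf : IsKanFibration f) (h₀ : IsRegularEpi (f.app (.op (.mk 0)))) (n : ℕ) :
    IsRegularEpi (Moore.map f n) := by
  obtain _ | n := n
  · exact h₀
  obtain ⟨z, hz⟩ := exists_isZeroHom (Moore.isZeroHom_ι_δ B n 0) (deg A n)
  -- The omitted face is the last one, so a filler of the zero horn has exactly the vanishing faces
  -- that define N_{n+1}A.
  obtain ⟨Y, p, a, hp, ha, haδ⟩ := hf n (Fin.last (n + 1)) (Moore.obj B (n + 1)) (fun _ _ => z)
    (Moore.ι B (n + 1)) (by
      obtain _ | n := n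
      · trivial
      · exact fun i j _ _ _ => (hz.comp _).eq (hz.comp _))
    (fun i hi => by
      obtain ⟨i, rfl⟩ := Fin.exists_castSucc_eq.2 hi
      exact (Moore.isZeroHom_ι_δ B n i).eq (hz.comp _))
  have haz : IsZeroHom (a ≫ faces A n) := isZeroHom_comp_faces a fun i => by
    rw [haδ _ (Fin.castSucc_lt_last i).ne]
    exact hz.precomp p
  obtain ⟨t, ht⟩ := (Moore.isKer_ι A n).lift a haz
  have e : t ≫ Moore.map f (n + 1) = p := by
    rw [← cancel_mono (Moore.ι B (n + 1)), Category.assoc, Moore.map_ι, ← ha, reassoc_of% ht]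
  exact IsRegularEpi.of_comp (f := t) (by rwa [e])

theorem normalization_isKer [HasFiniteLimits C] [QuasiPointed C] {K A B : SimplicialObject C}
    {k : K ⟶ A} {f : A ⟶ B} (h : IsKer k f) :
    IsKer ((normalization C).map k) ((normalization C).map f) :=
  PosChainComplex.isKer_of_f (Moore.isKer_map fun _ => isKer_app h _)

variable [Sequentiable C]

theorem isRegularEpi_normalization_map_f {A B : SimplicialObject C} (f : A ⟶ B)
    (hf : IsRegularEpi f) (n : ℕ) : IsRegularEpi (((normalization C).map f).f n) :=
  Moore.isRegularEpi_map (isKanFibration_of_isRegularEpi f hf) (isRegularEpi_app f _) n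

theorem isShortExact_normalization_of_isKer {K A B : SimplicialObject C} {k : K ⟶ A} {f : A ⟶ B}
    (h : IsKer k f) (hf : IsRegularEpi f) :
    IsShortExact ((normalization C).map k) ((normalization C).map f) :=
  ⟨normalization_isKer h, PosChainComplex.isCoker_of_f fun n =>
    have : IsRegularEpi (Moore.map f n) := isRegularEpi_normalization_map_f f hf n
    (Moore.isKer_map (fun _ => isKer_app h _) n).isCoker⟩

/-- Being a regular epimorphism of complexes is more than a degreewise condition; it holds because
the image of `f` is a cokernel of the image of the kernel of `f`. -/
theorem isRegularEpi_normalization_map {A B : SimplicialObject C} (f : A ⟶ B)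
    (hf : IsRegularEpi f) : IsRegularEpi ((normalization C).map f) := by
  have h : IsKer (pullback.fst f (initial.to B)) f :=
    ⟨⊥_ _, initialIsInitial, pullback.snd f (initial.to B), by
      rw [initialIsInitial.hom_ext (initialIsInitial.to B) (initial.to B)]
      exact IsPullback.of_hasPullback f (initial.to B)⟩
  exact (isShortExact_normalization_of_isKer h hf).2.isRegularEpi

theorem isExactFunctor_normalization : IsExactFunctor (normalization C) where
  isExactAt _ _ := by
    rintro ⟨I, e, m, he, rfl, hm⟩
    exact ⟨_, _, _, isRegularEpi_normalization_map e he, ((normalization C).map_comp e m).symm,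
      normalization_isKer hm⟩
  isShortExact _ _ h := isShortExact_normalization_of_isKer h.1 h.2.isRegularEpi
  isRegularEpi f hf := isRegularEpi_normalization_map f hf

end Moore

/-! ### Cycles and homology classes on generalized elements. -/

namespace ProperChainComplex

open PosChainComplex

variable {C : Type u} [Category.{v} C] [Sequentiable C]

/-- The projection from the cycles to the homology. -/
noncomputable def homologyπ (K : ProperChainComplex C) (n : ℕ) :
    K.obj.cycles n ⟶ (homology n).obj K :=
  cokerπ (K.obj.toCycles n) (isProper_toCycles K.obj K.property n)

theorem isCoker_homologyπ (K : ProperChainComplex C) (n : ℕ) :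
    IsCoker (K.obj.toCycles n) (homologyπ K n) :=
  isCoker_cokerπ _ (isProper_toCycles K.obj K.property n)

instance isRegularEpi_homologyπ (K : ProperChainComplex C) (n : ℕ) :
    IsRegularEpi (homologyπ K n) :=
  (isCoker_homologyπ K n).isRegularEpi

theorem isExactAt_homologyπ (K : ProperChainComplex C) (n : ℕ) :
    IsExactAt (K.obj.toCycles n) (homologyπ K n) :=
  (isProper_toCycles K.obj K.property n).isExactAt_cokerπ

/-- Local lifting of elements of the homology to cycles. -/
theorem exists_lift_homologyπ (K : ProperChainComplex C)
    {n : ℕ} {X : C} (a : X ⟶ (homology n).obj K) :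
    ∃ (Y : C) (p : Y ⟶ X) (z : Y ⟶ K.obj.cycles n), IsRegularEpi p ∧
      z ≫ homologyπ K n = p ≫ a :=
  IsRegularEpi.exists_lift inferInstance a

theorem homologyπ_map {K L : ProperChainComplex C} (φ : K ⟶ L) (n : ℕ) :
    homologyπ K n ≫ (homology n).map φ = cyclesMap φ.hom n ≫ homologyπ L n := by
  simp only [homology, homologyπ, cokerπ_desc]

theorem isKer_cyclesι (K : PosChainComplex C) (n : ℕ) : IsKer (K.cyclesι (n + 1)) (K.d n) :=
  isKer_kerι (K.d n)

/-- Elements of a subcomplex which are cycles in the ambient complex are cycles. -/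
theorem exists_cyclesι_of_mono {K L : PosChainComplex C} (φ : K ⟶ L) (hφ : ∀ n, Mono (φ.f n))
    {n : ℕ} {X : C} (x : X ⟶ K.X n) (w : X ⟶ L.cycles n) (h : x ≫ φ.f n = w ≫ L.cyclesι n) :
    ∃ y : X ⟶ K.cycles n, y ≫ K.cyclesι n = x := by
  obtain _ | n := n
  · exact ⟨x, Category.comp_id _⟩
  · refine (isKer_cyclesι K n).lift x (IsZeroHom.of_comp_mono (m := φ.f n) ?_)
    rw [Category.assoc, ← φ.comm, reassoc_of% h]
    exact (isKer_cyclesι L n).isZeroHom.precomp w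

/-- A sequence of proper complexes which is short exact in each degree. -/
structure IsDegreewiseShortExact {K L M : ProperChainComplex C} (k : K ⟶ L) (f : L ⟶ M) :
    Prop where
  isKer : ∀ n, IsKer (k.hom.f n) (f.hom.f n)
  isRegularEpi : ∀ n, IsRegularEpi (f.hom.f n)

/-- The connecting morphism sends the class of a cycle `z` to the class of a cycle `x` as soon as
`z` lifts to an element `l` whose boundary is `x`. -/
def IsConnecting {K L M : ProperChainComplex C} (k : K ⟶ L) (f : L ⟶ M) (n : ℕ)
    (δ : (homology (n + 1)).obj M ⟶ (homology n).obj K) : Prop :=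
  ∀ {X : C} (z : X ⟶ M.obj.cycles (n + 1)) (l : X ⟶ L.obj.X (n + 1)) (x : X ⟶ K.obj.cycles n),
    l ≫ f.hom.f (n + 1) = z ≫ M.obj.cyclesι (n + 1) →
    l ≫ L.obj.d n = x ≫ K.obj.cyclesι n ≫ k.hom.f n →
    z ≫ homologyπ M (n + 1) ≫ δ = x ≫ homologyπ K n

/-! ### The connecting morphism and the long exact homology sequence. -/

namespace IsDegreewiseShortExact

variable {K L M : ProperChainComplex C} {k : K ⟶ L} {f : L ⟶ M} (h : IsDegreewiseShortExact k f)

include h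

theorem isKer_cyclesMap (n : ℕ) : IsKer (cyclesMap k.hom n) (cyclesMap f.hom n) := by
  have hm := fun n => (h.isKer n).mono
  have : Mono (cyclesMap k.hom n) := by
    have : Mono (cyclesMap k.hom n ≫ L.obj.cyclesι n) := by rw [cyclesMap_ι]; infer_instance
    exact mono_of_mono _ (L.obj.cyclesι n)
  refine IsKer.of_lift (IsZeroHom.of_comp_mono (m := M.obj.cyclesι n) ?_) fun g hg => ?_
  · rw [Category.assoc, cyclesMap_ι, ← Category.assoc, cyclesMap_ι, Category.assoc]
    exact (h.isKer n).isZeroHom.precomp _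
  obtain ⟨t, ht⟩ := (h.isKer n).lift (g ≫ L.obj.cyclesι n) (by
    rw [Category.assoc, ← cyclesMap_ι, ← Category.assoc]
    exact hg.comp _)
  obtain ⟨y, hy⟩ := exists_cyclesι_of_mono k.hom hm t g ht
  exact ⟨y, by rw [← cancel_mono (L.obj.cyclesι n), Category.assoc, cyclesMap_ι, reassoc_of% hy,
    ht]⟩

/-- If `l` lifts a cycle, then the boundary of `l` comes from a cycle. -/
theorem exists_cycle {n : ℕ} {X : C} (z : X ⟶ M.obj.cycles (n + 1)) (l : X ⟶ L.obj.X (n + 1))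
    (hl : l ≫ f.hom.f (n + 1) = z ≫ M.obj.cyclesι (n + 1)) :
    ∃ x : X ⟶ K.obj.cycles n, l ≫ L.obj.d n = x ≫ K.obj.cyclesι n ≫ k.hom.f n := by
  obtain ⟨y, hy⟩ := (h.isKer n).lift (l ≫ L.obj.d n) (by
    rw [Category.assoc, ← f.hom.comm, reassoc_of% hl]
    exact (isKer_cyclesι M.obj n).isZeroHom.precomp z)
  obtain ⟨x, hx⟩ := exists_cyclesι_of_mono k.hom (fun n => (h.isKer n).mono) y
    (l ≫ L.obj.toCycles n) (by rw [hy, Category.assoc, toCycles_ι])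
  exact ⟨x, by rw [reassoc_of% hx, hy]⟩

theorem exists_lift_cycle {n : ℕ} {X : C} (z : X ⟶ M.obj.cycles (n + 1)) :
    ∃ (Y : C) (p : Y ⟶ X) (l : Y ⟶ L.obj.X (n + 1)) (x : Y ⟶ K.obj.cycles n), IsRegularEpi p ∧
      l ≫ f.hom.f (n + 1) = (p ≫ z) ≫ M.obj.cyclesι (n + 1) ∧
      l ≫ L.obj.d n = x ≫ K.obj.cyclesι n ≫ k.hom.f n := by
  obtain ⟨Y, p, l, hp, hl⟩ := (h.isRegularEpi (n + 1)).exists_lift (z ≫ M.obj.cyclesι (n + 1))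
  rw [← Category.assoc] at hl
  obtain ⟨x, hx⟩ := h.exists_cycle (p ≫ z) l hl
  exact ⟨Y, p, l, x, hp, hl, hx⟩

/-- The object of pairs (l, z) with f l = z covers the cycles of `M`. Taking the class of the
boundary of l gives a morphism to H_n K, which descends first to the cycles and then to the homology
of `M`. -/
theorem exists_isConnecting (n : ℕ) : ∃ δ : (homology (n + 1)).obj M ⟶ (homology n).obj K,
    IsConnecting k f n δ := by
  have hm := fun n => (h.isKer n).mono
  have hf := h.isRegularEpi
  let l₀ := pullback.fst (f.hom.f (n + 1)) (M.obj.cyclesι (n + 1))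
  let z₀ := pullback.snd (f.hom.f (n + 1)) (M.obj.cyclesι (n + 1))
  have hlz : l₀ ≫ f.hom.f (n + 1) = z₀ ≫ M.obj.cyclesι (n + 1) := pullback.condition
  obtain ⟨x₀, hx₀⟩ := h.exists_cycle z₀ l₀ hlz
  -- If z = 0, then l comes from `K`, and `x₀` is its boundary in `K`.
  have hker : IsZeroHom (kerι z₀ ≫ x₀ ≫ homologyπ K n) := by
    obtain ⟨v, hv⟩ := (h.isKer (n + 1)).lift (kerι z₀ ≫ l₀) (by
      rw [Category.assoc, hlz, ← Category.assoc]
      exact (isKer_kerι z₀).isZeroHom.comp _)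
    have e : kerι z₀ ≫ x₀ = v ≫ K.obj.toCycles n := by
      rw [← cancel_mono (K.obj.cyclesι n), ← cancel_mono (k.hom.f n)]
      simp only [Category.assoc, toCycles_ι, ← hx₀]
      rw [← k.hom.comm, reassoc_of% hv]
    rw [reassoc_of% e]
    exact (isCoker_homologyπ K n).isZeroHom.precomp v
  obtain ⟨ψ, hψ⟩ := (isCoker_kerι z₀).desc _ hker
  obtain ⟨δ, hδ⟩ := (isCoker_homologyπ M (n + 1)).desc ψ (by
    refine IsZeroHom.of_strongEpi_comp (e := f.hom.f (n + 2)) ?_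
    -- A boundary in `M` is locally the image of a boundary d l' of `L`; the pair so obtained gives
    -- zero since d d l' = 0.
    let w := pullback.lift (f := f.hom.f (n + 1)) (g := M.obj.cyclesι (n + 1)) (L.obj.d (n + 1))
      (f.hom.f (n + 2) ≫ M.obj.toCycles (n + 1))
      (by rw [Category.assoc, toCycles_ι, f.hom.comm])
    have hw₁ : w ≫ l₀ = L.obj.d (n + 1) := pullback.lift_fst _ _ _
    have hw₂ : w ≫ z₀ = f.hom.f (n + 2) ≫ M.obj.toCycles (n + 1) := pullback.lift_snd _ _ _
    rw [← Category.assoc, ← hw₂, Category.assoc, hψ, ← Category.assoc]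
    refine IsZeroHom.comp (IsZeroHom.of_comp_mono (m := K.obj.cyclesι n ≫ k.hom.f n) ?_) _
    rw [Category.assoc, ← hx₀, reassoc_of% hw₁]
    exact L.obj.d_comp_d n)
  refine ⟨δ, fun {X} z l x hl hx => ?_⟩
  let u : X ⟶ _ := pullback.lift l z hl
  have hu₁ : u ≫ l₀ = l := pullback.lift_fst _ _ _
  have hu₂ : u ≫ z₀ = z := pullback.lift_snd _ _ _
  have e : u ≫ x₀ = x := by
    rw [← cancel_mono (K.obj.cyclesι n), ← cancel_mono (k.hom.f n), Category.assoc, Category.assoc,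
      ← hx₀, reassoc_of% hu₁, hx, Category.assoc]
  rw [hδ, ← hu₂, Category.assoc, hψ, reassoc_of% e]

theorem isExactAt_homology_map (n : ℕ) :
    IsExactAt ((homology n).map k) ((homology n).map f) := by
  refine IsExactAt.of_exists_lift ?_ fun {X} a ha => ?_
  · refine IsZeroHom.of_strongEpi_comp (e := homologyπ K n) ?_
    rw [reassoc_of% homologyπ_map, homologyπ_map, ← Category.assoc]
    exact (h.isKer_cyclesMap n).isZeroHom.comp _
  obtain ⟨Y₁, p₁, z, hp₁, hz⟩ := exists_lift_homologyπ L a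
  have hzf : IsZeroHom ((z ≫ cyclesMap f.hom n) ≫ homologyπ M n) := by
    rw [Category.assoc, ← homologyπ_map, reassoc_of% hz]
    exact ha.precomp p₁
  obtain ⟨Y₂, p₂, m, hp₂, hm⟩ := (isExactAt_homologyπ M n).exists_lift _ hzf
  obtain ⟨Y₃, p₃, l, hp₃, hl⟩ := (h.isRegularEpi (n + 1)).exists_lift m
  obtain ⟨o, ho⟩ := exists_isZeroHom ((hzf.precomp p₂).precomp p₃) (L.obj.cycles n)
  -- `b` replaces z − d l: its image in `M` vanishes and its class is that of z.
  obtain ⟨Y₄, p₄, b, hp₄, hb₁, hb₂⟩ := exists_difunctional (cyclesMap f.hom n) (homologyπ L n)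
    (p₃ ≫ p₂ ≫ z) (l ≫ L.obj.toCycles n) o
    (by
      rw [Category.assoc, Category.assoc, ← hm, Category.assoc, toCycles_map, reassoc_of% hl])
    (by
      rw [Category.assoc]
      exact ((isCoker_homologyπ L n).isZeroHom.precomp l).eq (ho.comp _))
  obtain ⟨x, hx⟩ := (h.isKer_cyclesMap n).lift b (by
    rw [hb₁]
    exact (ho.comp _).precomp p₄)
  refine ⟨Y₄, p₄ ≫ p₃ ≫ p₂ ≫ p₁, x ≫ homologyπ K n, hp₄.comp (hp₃.comp (hp₂.comp hp₁)), ?_⟩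
  rw [Category.assoc, homologyπ_map, reassoc_of% hx, hb₂]
  simp only [Category.assoc, hz]

theorem isRegularEpi_homology_zero_map : IsRegularEpi ((homology 0).map f) := by
  -- Only in degree 0 is the map on cycles the component of `f` itself, hence a regular epimorphism.
  have h₀ : IsRegularEpi (cyclesMap f.hom 0) := h.isRegularEpi 0
  refine IsRegularEpi.of_comp (f := homologyπ L 0) ?_
  rw [homologyπ_map]
  exact h₀.comp inferInstance

variable {n : ℕ} {δ : (homology (n + 1)).obj M ⟶ (homology n).obj K} (hδ : IsConnecting k f n δ)

include hδ

/-- If k x = d l, then f l is a cycle and the defining property gives δ[f l] = [x]. Conversely, k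
sends a representative of δ[z] to a boundary. -/
theorem isExactAt_connecting_map : IsExactAt δ ((homology n).map k) := by
  refine IsExactAt.of_exists_lift ?_ fun {X} a ha => ?_
  · obtain ⟨Y, p, l, x, hp, hl, hx⟩ := h.exists_lift_cycle (𝟙 (M.obj.cycles (n + 1)))
    have hp' : IsRegularEpi (p ≫ homologyπ M (n + 1)) := hp.comp inferInstance
    refine IsZeroHom.of_strongEpi_comp (e := p ≫ homologyπ M (n + 1)) ?_
    have e := hδ _ l x hl hx
    have ex : x ≫ cyclesMap k.hom n = l ≫ L.obj.toCycles n := by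
      rw [← cancel_mono (L.obj.cyclesι n), Category.assoc, cyclesMap_ι, Category.assoc, toCycles_ι,
        hx]
    rw [Category.comp_id] at e
    rw [Category.assoc, reassoc_of% e, homologyπ_map, reassoc_of% ex]
    exact (isCoker_homologyπ L n).isZeroHom.precomp l
  obtain ⟨Y₁, p₁, x, hp₁, hx⟩ := exists_lift_homologyπ K a
  have hxk : IsZeroHom ((x ≫ cyclesMap k.hom n) ≫ homologyπ L n) := by
    rw [Category.assoc, ← homologyπ_map, reassoc_of% hx]
    exact ha.precomp p₁
  obtain ⟨Y₂, p₂, l, hp₂, hl⟩ := (isExactAt_homologyπ L n).exists_lift _ hxk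
  have hl' : l ≫ L.obj.d n = (p₂ ≫ x) ≫ K.obj.cyclesι n ≫ k.hom.f n := by
    rw [← toCycles_ι, reassoc_of% hl, cyclesMap_ι, Category.assoc]
  obtain ⟨z, hz⟩ := (isKer_cyclesι M.obj n).lift (l ≫ f.hom.f (n + 1)) (by
    rw [Category.assoc, f.hom.comm, reassoc_of% hl']
    exact (((h.isKer n).isZeroHom.precomp _).precomp x).precomp p₂)
  refine ⟨Y₂, p₂ ≫ p₁, z ≫ homologyπ M (n + 1), hp₂.comp hp₁, ?_⟩
  rw [Category.assoc, hδ z l (p₂ ≫ x) hz.symm hl', Category.assoc, hx, Category.assoc]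

theorem isExactAt_map_connecting : IsExactAt ((homology (n + 1)).map f) δ := by
  refine IsExactAt.of_exists_lift ?_ fun {X} a ha => ?_
  · have hz := (isKer_cyclesι L.obj n).isZeroHom
    obtain ⟨o, ho⟩ := exists_isZeroHom hz (K.obj.cycles n)
    refine IsZeroHom.of_strongEpi_comp (e := homologyπ L (n + 1)) ?_
    -- A cycle of `L` is its own lift and has zero boundary, so zero represents its connecting
    -- class.
    rw [reassoc_of% homologyπ_map, hδ _ (L.obj.cyclesι (n + 1)) o (cyclesMap_ι _ _).symm
      (hz.eq (ho.comp _))]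
    exact ho.comp _
  obtain ⟨Y₁, p₁, z, hp₁, hz⟩ := exists_lift_homologyπ M a
  obtain ⟨Y₂, p₂, l, x, hp₂, hl, hx⟩ := h.exists_lift_cycle z
  have e := hδ _ l x hl hx
  have hx₀ : IsZeroHom (x ≫ homologyπ K n) := by
    rw [← e, Category.assoc, reassoc_of% hz]
    exact (ha.precomp p₁).precomp p₂
  obtain ⟨Y₃, p₃, y, hp₃, hy⟩ := (isExactAt_homologyπ K n).exists_lift x hx₀
  obtain ⟨o, ho⟩ := exists_isZeroHom (hx₀.precomp p₃) (L.obj.X (n + 1))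
  -- Here l and k y have the same boundary; `b` replaces l − k y, a cycle with the same image z in
  -- `M`.
  obtain ⟨Y₄, p₄, b, hp₄, hb₁, hb₂⟩ := exists_difunctional (L.obj.d n) (f.hom.f (n + 1))
    (p₃ ≫ l) (y ≫ k.hom.f (n + 1)) o
    (by
      rw [Category.assoc, hx, ← reassoc_of% hy, Category.assoc, k.hom.comm, ← toCycles_ι,
        Category.assoc])
    (by
      rw [Category.assoc]
      exact ((h.isKer (n + 1)).isZeroHom.precomp y).eq (ho.comp _))
  obtain ⟨w, hw⟩ := (isKer_cyclesι L.obj n).lift b (by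
    rw [hb₁]
    exact (ho.comp _).precomp p₄)
  have hwz : w ≫ cyclesMap f.hom (n + 1) = p₄ ≫ p₃ ≫ p₂ ≫ z := by
    rw [← cancel_mono (M.obj.cyclesι (n + 1)), Category.assoc, cyclesMap_ι, reassoc_of% hw, hb₂,
      Category.assoc, hl]
    simp only [Category.assoc]
  refine ⟨Y₄, p₄ ≫ p₃ ≫ p₂ ≫ p₁, w ≫ homologyπ L (n + 1),
    hp₄.comp (hp₃.comp (hp₂.comp hp₁)), ?_⟩
  rw [Category.assoc, homologyπ_map, reassoc_of% hwz, hz]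
  simp only [Category.assoc]

/-- Mapping z, l and x forward gives admissible data for `δ'`. The two sides thus agree after an
epimorphism onto the homology of `M`. -/
theorem connecting_naturality {K' L' M' : ProperChainComplex C} {k' : K' ⟶ L'} {f' : L' ⟶ M'}
    {δ' : (homology (n + 1)).obj M' ⟶ (homology n).obj K'} (hδ' : IsConnecting k' f' n δ')
    (a : K ⟶ K') (b : L ⟶ L') (c : M ⟶ M') (w₁ : k ≫ b = a ≫ k') (w₂ : f ≫ c = b ≫ f') :
    δ ≫ (homology n).map a = (homology (n + 1)).map c ≫ δ' := by
  obtain ⟨Y, p, l, x, hp, hl, hx⟩ := h.exists_lift_cycle (𝟙 (M.obj.cycles (n + 1)))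
  have w₁' : ∀ n, k.hom.f n ≫ b.hom.f n = a.hom.f n ≫ k'.hom.f n := fun n =>
    congrArg (fun t : K ⟶ L' => t.hom.f n) w₁
  have w₂' : ∀ n, f.hom.f n ≫ c.hom.f n = b.hom.f n ≫ f'.hom.f n := fun n =>
    congrArg (fun t : L ⟶ M' => t.hom.f n) w₂
  have e := hδ _ l x hl hx
  have e' := hδ' (p ≫ cyclesMap c.hom (n + 1)) (l ≫ b.hom.f (n + 1)) (x ≫ cyclesMap a.hom n)
    (by
      rw [Category.assoc, ← w₂', reassoc_of% hl, Category.assoc, cyclesMap_ι])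
    (by
      rw [Category.assoc, b.hom.comm, reassoc_of% hx, w₁', Category.assoc,
        reassoc_of% cyclesMap_ι])
  rw [Category.comp_id] at e
  have : Epi p := inferInstance
  rw [← cancel_epi (homologyπ M (n + 1)), ← cancel_epi p, reassoc_of% e, homologyπ_map,
    reassoc_of% homologyπ_map]
  simpa only [Category.assoc] using e'.symm

end IsDegreewiseShortExact

end ProperChainComplex

end SemiAbelian

/-! ### Assembly of the theorem. -/

open SemiAbelian
theorem mainTheorem5 {C : Type u} [Category.{v} C] [Sequentiable C] [BarrExact C] :
    (∀ {A B : SimplicialObject C} (f : A ⟶ B), IsRegularEpi f → IsKanFibration f) ∧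
    ∃ hN : ∀ A : SimplicialObject C, PosChainComplex.isProper C ((normalization C).obj A),
      IsExactFunctor (properNormalization C hN ⋙ (PosChainComplex.isProper C).ι) ∧
      ∃ δ : ∀ (n : ℕ) (S : ShortExactSeq (SimplicialObject C)),
          (properNormalization C hN ⋙ homology (n + 1)).obj S.X₃ ⟶
            (properNormalization C hN ⋙ homology n).obj S.X₁,
        IsNaturalLongExact (fun n => properNormalization C hN ⋙ homology n) δ := by
  have hN : ∀ A : SimplicialObject C, PosChainComplex.isProper C ((normalization C).obj A) :=
    fun A n => Moore.isProper_d A n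
  have h : ∀ S : ShortExactSeq (SimplicialObject C), ProperChainComplex.IsDegreewiseShortExact
      ((properNormalization C hN).map S.k) ((properNormalization C hN).map S.f) := fun S =>
    { isKer := Moore.isKer_map fun _ => isKer_app S.exact.1 _
      isRegularEpi := isRegularEpi_normalization_map_f S.f S.exact.2.isRegularEpi }
  -- Naturality survives this choice, since the defining property determines the connecting
  -- morphism.
  choose δ hδ using fun (n : ℕ) (S : ShortExactSeq (SimplicialObject C)) =>
    (h S).exists_isConnecting n
  refine ⟨isKanFibration_of_isRegularEpi, hN, isExactFunctor_normalization, δ,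
    { exact₁ := fun n S => (h S).isExactAt_connecting_map (hδ n S)
      exact₂ := fun n S => (h S).isExactAt_homology_map n
      exact₃ := fun n S => (h S).isExactAt_map_connecting (hδ n S)
      regularEpi := fun S => (h S).isRegularEpi_homology_zero_map
      naturality := fun n S T φ => (h S).connecting_naturality (hδ n S) (hδ n T) _
        ((properNormalization C hN).map φ.τ₂) _ ?_ ?_ }⟩
  · exact ((properNormalization C hN).map_comp _ _).symm.trans
      ((congrArg _ φ.comm_k).trans ((properNormalization C hN).map_comp _ _))
  · exact ((properNormalization C hN).map_comp _ _).symm.trans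
      ((congrArg _ φ.comm_f).trans ((properNormalization C hN).map_comp _ _))
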